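/- Setting. Let $(\Omega,\mathcal F)$ be a measurable space. For $n\ge1$ let $C_{l,Lip}(\mathbb R^n)$ be the set of $\varphi:\mathbb R^n\to\mathbb R$ with $|\varphi(x)-\varphi(y)|\le C(1+|x|^m+|y|^m)|x-y|$ for all $x,y$ and some $C>0$, $m\in\mathbb N$. Let $\mathscr H$ be a linear space of measurable real functions on $\Omega$ such that $\varphi(X_1,\dots,X_n)\in\mathscr H$ whenever $X_1,\dots,X_n\in\mathscr H$ and $\varphi\in C_{l,Lip}(\mathbb R^n)$. Let $\hat{\mathbb E}:\mathscr H\to[-\infty,\infty]$ be a sub-linear expectation: it is monotone; $\hat{\mathbb E}[c]=c$ for constants $c$; $\hat{\mathbb E}[X+Y]\le\hat{\mathbb E}[X]+\hat{\mathbb E}[Y]$ whenever the right side is not of the form $\infty-\infty$ or $-\infty+\infty$; and $\hat{\mathbb E}[\lambda X]=\lambda\hat{\mathbb E}[X]$ for $\lambda\ge0$. Put $\hat{\mathcal E}[X]=-\hat{\mathbb E}[-X]$ and, for $A\in\mathcal F$, $\mathbb V(A)=\inf\{\hat{\mathbb E}[\xi]: I_A\le\xi,\ \xi\in\mathscr H\}$.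 For measurable $X$ put $C_{\mathbb V}[X]=\int_0^\infty\mathbb V(X\ge t)\,dt+\int_{-\infty}^0[\mathbb V(X\ge t)-1]\,dt$. $\mathbb V$ is countably sub-additive if $\mathbb V(\bigcup_n A_n)\le\sum_n\mathbb V(A_n)$ for all $A_n\in\mathcal F$; it is continuous if $\mathbb V(A_n)\to\mathbb V(A)$ whenever $A_n,A\in\mathcal F$ and $A_n\uparrow A$ or $A_n\downarrow A$. Let $X_1,X_2,\dots\in\mathscr H$. They are identically distributed if, for all $i$ and all $\varphi\in C_{l,Lip}(\mathbb R)$, $\hat{\mathbb E}[\varphi(X_i)]=\hat{\mathbb E}[\varphi(X_1)]$ whenever both are finite. They are independent if, for each $i\ge1$, $Y=X_{i+1}$ is independent to $\mathbf X=(X_1,\dots,X_i)$, i.e. $\hat{\mathbb E}[\varphi(\mathbf X,Y)]=\hat{\mathbb E}\big[\hat{\mathbb E}[\varphi(x,Y)]|_{x=\mathbf X}\big]$ for all $\varphi\in C_{l,Lip}(\mathbb R^{i}\times\mathbb R)$ such that $\bar\varphi(x):=\hat{\mathbb E}[|\varphi(x,Y)|]<\infty$ for all $x$ and $\hat{\mathbb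 E}[\bar\varphi(\mathbf X)]<\infty$ (the functions $\bar\varphi(\mathbf X)$ and $\hat{\mathbb E}[\varphi(x,Y)]|_{x=\mathbf X}$ being required to lie in $\mathscr H$). They are negatively dependent if, for each $i\ge1$, with $Y$ and $\mathbf X$ as before, $\hat{\mathbb E}[\varphi_1(\mathbf X)\varphi_2(Y)]\le\hat{\mathbb E}[\varphi_1(\mathbf X)]\,\hat{\mathbb E}[\varphi_2(Y)]$ for all $\varphi_1\in C_{l,Lip}(\mathbb R^i)$, $\varphi_2\in C_{l,Lip}(\mathbb R)$, both coordinatewise non-decreasing or both coordinatewise non-increasing, with $\varphi_1(\mathbf X)\ge0$, $\hat{\mathbb E}[\varphi_2(Y)]\ge0$, and $\hat{\mathbb E}[|\varphi_1(\mathbf X)\varphi_2(Y)|]$, $\hat{\mathbb E}[|\varphi_1(\mathbf X)|]$, $\hat{\mathbb E}[|\varphi_2(Y)|]$ all finite. Put $S_n=X_1+\dots+X_n$. Theorem. Let $X_1,X_2,\dots\in\mathscr H$ be identically distributed. (a) If $X_1,X_2,\dots$ are negatively dependent, $\mathbb V$ is countably sub-additive, $C_{\mathbb V}[|X_1|]<\infty$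 and $\lim_{c\to\infty}\hat{\mathbb E}[(|X_1|-c)^+]=0$, then $$\mathbb V\Big(\Big\{\liminf_{n\to\infty}\frac{S_n}{n}<\hat{\mathcal E}[X_1]\Big\}\cup\Big\{\limsup_{n\to\infty}\frac{S_n}{n}>\hat{\mathbb E}[X_1]\Big\}\Big)=0.$$ (b) If $X_1,X_2,\dots$ are independent, $\mathbb V$ is continuous and $\mathbb V\big(\limsup_{n\to\infty}|S_n|/n=+\infty\big)<1$, then $C_{\mathbb V}[|X_1|]<\infty$. (c) If $X_1,X_2,\dots$ are independent, $\mathbb V$ is continuous, $C_{\mathbb V}[|X_1|]<\infty$ and $\lim_{c\to\infty}\hat{\mathbb E}[(|X_1|-c)^+]=0$, then $$\mathbb V\Big(\liminf_{n\to\infty}\frac{S_n}{n}=\hat{\mathcal E}[X_1]\ \text{ and }\ \limsup_{n\to\infty}\frac{S_n}{n}=\hat{\mathbb E}[X_1]\Big)=1$$ and $$\mathbb V\Big(C\Big\{\frac{S_n}{n}\Big\}=\big[\hat{\mathcal E}[X_1],\hat{\mathbb E}[X_1]\big]\Big)=1,$$ where $C\{x_n\}$ denotes the set of cluster points in $\mathbb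 R$ of the sequence $(x_n)$. -/

import Mathlib

open Filter Topology MeasureTheory
open scoped ENNReal

/-- The class `C_{l,Lip}` of local Lipschitz functions of polynomial growth:
`|φ x - φ y| ≤ C (1 + |x|^m + |y|^m) |x - y|` for some `C > 0`, `m ∈ ℕ`.
It is used on `Fin n → ℝ` and on products of such spaces; as all norms on a finite-dimensional
space are equivalent, the class does not depend on the norm. -/
def LocLip {E : Type*} [NormedAddCommGroup E] (φ : E → ℝ) : Prop :=
  ∃ C : ℝ, 0 < C ∧ ∃ m : ℕ, ∀ x y : E,
    |φ x - φ y| ≤ C * (1 + ‖x‖ ^ m + ‖y‖ ^ m) * ‖x - y‖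

/-- The value at `ω` of a random vector given by its components. -/
def rvec {Ω : Type*} {n : ℕ} (X : Fin n → Ω → ℝ) (ω : Ω) : Fin n → ℝ := fun i => X i ω

/-- A sub-linear expectation space `(Ω, H, E)`: a linear space `H` of (measurable) real functions
on a measurable space, stable under `C_{l,Lip}` functions of finitely many members, with a
sub-linear expectation `E : H → [-∞, ∞]`.  `E` is written as a function of all real functions on
`Ω`; only its values on `H` carry meaning, and only these are used below. -/
structure SublinExpSpace (Ω : Type*) [MeasurableSpace Ω] where
  /-- the space of random variables -/
  H : Submodule ℝ (Ω → ℝ)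
  measurable_of_mem : ∀ X ∈ H, Measurable X
  comp_mem : ∀ (n : ℕ) (X : Fin n → Ω → ℝ), (∀ i, X i ∈ H) →
    ∀ φ : (Fin n → ℝ) → ℝ, LocLip φ → (fun ω => φ (rvec X ω)) ∈ H
  /-- the sub-linear (upper) expectation -/
  E : (Ω → ℝ) → EReal
  mono : ∀ X ∈ H, ∀ Y ∈ H, (∀ ω, Y ω ≤ X ω) → E Y ≤ E X
  const : ∀ c : ℝ, E (fun _ => c) = (c : EReal)
  subadd : ∀ X ∈ H, ∀ Y ∈ H, ¬ (E X = ⊤ ∧ E Y = ⊥) → ¬ (E X = ⊥ ∧ E Y = ⊤) →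
    E (fun ω => X ω + Y ω) ≤ E X + E Y
  pos_hom : ∀ X ∈ H, ∀ c : ℝ, 0 ≤ c → E (fun ω => c * X ω) = (c : EReal) * E X

namespace SublinExpSpace

variable {Ω : Type*} [MeasurableSpace Ω]

/-- The conjugate (lower) expectation. -/
noncomputable def lowerE (S : SublinExpSpace Ω) (X : Ω → ℝ) : EReal :=
  -S.E (fun ω => -X ω)

/-- The upper capacity `V(A) = inf {E ξ : 1_A ≤ ξ, ξ ∈ H}`.  All these `E ξ` are nonnegative,
so nothing is lost in passing to `ℝ≥0∞`. -/
noncomputable def cap (S : SublinExpSpace Ω) (A : Set Ω) : ℝ≥0∞ :=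
  (sInf (S.E '' {ξ | ξ ∈ S.H ∧ ∀ ω, A.indicator (fun _ => (1 : ℝ)) ω ≤ ξ ω})).toENNReal

/-- Two random vectors, possibly on different sub-linear expectation spaces, are identically
distributed if `E₁[φ(X)] = E₂[φ(Y)]` for all `φ ∈ C_{l,Lip}` whenever both sides are finite. -/
def IdentDist {Ω' : Type*} [MeasurableSpace Ω'] (S : SublinExpSpace Ω) (S' : SublinExpSpace Ω')
    {n : ℕ} (X : Fin n → Ω → ℝ) (Y : Fin n → Ω' → ℝ) : Prop :=
  ∀ φ : (Fin n → ℝ) → ℝ, LocLip φ →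
    S.E (fun ω => φ (rvec X ω)) ≠ ⊤ → S.E (fun ω => φ (rvec X ω)) ≠ ⊥ →
    S'.E (fun ω => φ (rvec Y ω)) ≠ ⊤ → S'.E (fun ω => φ (rvec Y ω)) ≠ ⊥ →
    S.E (fun ω => φ (rvec X ω)) = S'.E (fun ω => φ (rvec Y ω))

/-- `Y` is independent to `X`:
`E[φ(X, Y)] = E[E[φ(x, Y)]|_{x = X}]` for every `φ ∈ C_{l,Lip}`, whenever
`φ̄(x) = E|φ(x, Y)| < ∞` for all `x` and `E[φ̄(X)] < ∞`.  As `E` is a functional on `H`, this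
presupposes that `φ̄(X)` and `E[φ(x, Y)]|_{x = X}` lie in `H`.  The values turned into reals by
`EReal.toReal` are finite since `φ̄ < ∞`. -/
def IndepTo (S : SublinExpSpace Ω) {m n : ℕ} (Y : Fin n → Ω → ℝ) (X : Fin m → Ω → ℝ) : Prop :=
  ∀ φ : (Fin m → ℝ) × (Fin n → ℝ) → ℝ, LocLip φ →
    (∀ x : Fin m → ℝ, S.E (fun ω' => |φ (x, rvec Y ω')|) < ⊤) →
    (fun ω => (S.E (fun ω' => |φ (rvec X ω, rvec Y ω')|)).toReal) ∈ S.H →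
    S.E (fun ω => (S.E (fun ω' => |φ (rvec X ω, rvec Y ω')|)).toReal) < ⊤ →
    (fun ω => (S.E (fun ω' => φ (rvec X ω, rvec Y ω'))).toReal) ∈ S.H →
    S.E (fun ω => φ (rvec X ω, rvec Y ω)) =
      S.E (fun ω => (S.E (fun ω' => φ (rvec X ω, rvec Y ω'))).toReal)

/-- `Y` is negatively dependent to `X`. -/
def NegDepTo (S : SublinExpSpace Ω) {m n : ℕ} (Y : Fin n → Ω → ℝ) (X : Fin m → Ω → ℝ) : Prop :=
  ∀ (φ₁ : (Fin m → ℝ) → ℝ) (φ₂ : (Fin n → ℝ) → ℝ), LocLip φ₁ → LocLip φ₂ →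
    (∀ ω, 0 ≤ φ₁ (rvec X ω)) →
    0 ≤ S.E (fun ω => φ₂ (rvec Y ω)) →
    S.E (fun ω => |φ₁ (rvec X ω) * φ₂ (rvec Y ω)|) < ⊤ →
    S.E (fun ω => |φ₁ (rvec X ω)|) < ⊤ →
    S.E (fun ω => |φ₂ (rvec Y ω)|) < ⊤ →
    ((Monotone φ₁ ∧ Monotone φ₂) ∨ (Antitone φ₁ ∧ Antitone φ₂)) →
    S.E (fun ω => φ₁ (rvec X ω) * φ₂ (rvec Y ω)) ≤
      S.E (fun ω => φ₁ (rvec X ω)) * S.E (fun ω => φ₂ (rvec Y ω))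

/-- A sequence (`X 0` is the first member) is identically distributed. -/
def IdentDistSeq (S : SublinExpSpace Ω) (X : ℕ → Ω → ℝ) : Prop :=
  ∀ i : ℕ, IdentDist S S (fun _ : Fin 1 => X i) (fun _ : Fin 1 => X 0)

/-- A sequence is independent: each member is independent to the vector of its predecessors. -/
def IndepSeq (S : SublinExpSpace Ω) (X : ℕ → Ω → ℝ) : Prop :=
  ∀ i : ℕ, S.IndepTo (fun _ : Fin 1 => X (i + 1)) (fun k : Fin (i + 1) => X k)

/-- A sequence is negatively dependent: each member is negatively dependent to the vector of its
predecessors. -/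
def NegDepSeq (S : SublinExpSpace Ω) (X : ℕ → Ω → ℝ) : Prop :=
  ∀ i : ℕ, S.NegDepTo (fun _ : Fin 1 => X (i + 1)) (fun k : Fin (i + 1) => X k)

end SublinExpSpace

/-- Countable sub-additivity of a set function on the measurable sets. -/
def CountablySubadditive {Ω : Type*} [MeasurableSpace Ω] (V : Set Ω → ℝ≥0∞) : Prop :=
  ∀ A : ℕ → Set Ω, (∀ n, MeasurableSet (A n)) → V (⋃ n, A n) ≤ ∑' n, V (A n)

/-- Continuity from below and from above of a set function on the measurable sets. -/
def ContinuousCapacity {Ω : Type*} [MeasurableSpace Ω] (V : Set Ω → ℝ≥0∞) : Prop :=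
  (∀ A : ℕ → Set Ω, (∀ n, MeasurableSet (A n)) → Monotone A →
    Tendsto (fun n => V (A n)) atTop (𝓝 (V (⋃ n, A n)))) ∧
  (∀ A : ℕ → Set Ω, (∀ n, MeasurableSet (A n)) → Antitone A →
    Tendsto (fun n => V (A n)) atTop (𝓝 (V (⋂ n, A n))))

/-- The Choquet integral `∫₀^∞ V(X ≥ t) dt + ∫_{-∞}^0 [V(X ≥ t) - 1] dt` of `X` with respect to a
set function with values in `[0, 1]`. -/
noncomputable def choquet {Ω : Type*} (V : Set Ω → ℝ≥0∞) (X : Ω → ℝ) : EReal :=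
  ((∫⁻ t in Set.Ioi (0 : ℝ), V {ω | t ≤ X ω} : ℝ≥0∞) : EReal) -
    ((∫⁻ t in Set.Iio (0 : ℝ), (1 - V {ω | t ≤ X ω}) : ℝ≥0∞) : EReal)

/-- The average `S_n / n` of the first `n` members of a sequence. -/
noncomputable def avg {Ω : Type*} (X : ℕ → Ω → ℝ) (n : ℕ) (ω : Ω) : ℝ :=
  (∑ k ∈ Finset.range n, X k ω) / n

/-- The set of cluster points in `ℝ` of a real sequence. -/
def clusterSet (x : ℕ → ℝ) : Set ℝ := {a | MapClusterPt a atTop x}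

/-! Estimates are made on bounded Lipschitz functions of the variables, where the expectation is a
finite sub-linear functional `e`; `cap_le` and `le_cap` turn bounds on `e` into bounds on the
capacity.

Upper bounds. Expand the square of the positive part of a sum of centred truncated variables. The
cross term pairs a nonnegative monotone function of the past with a centred monotone function of the
present, so its expectation is at most zero, and `second_moment` gives a variance-type bound. With
truncation at `2 ^ l` in blocks of length comparable to `2 ^ l`, finiteness of the Choquet integral
makes both the truncation errors and the Chebyshev bounds summable in `l`. Borel–Cantelli then
controls the block sums (`cap_block_frequently`). A finite grid of dyadic blocks interpolates to all
`n` (`cap_upper_frequently`), with positive parts bounding the sum over the last incomplete block,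
so no maximal inequality is needed. Reflection gives the lower bound. Independence yields the same
covariance condition, so these bounds also serve (c).

Converse (b). Under independence `-∏ (1 - f i)` is affine with nonnegative coefficient in each `f
i`, so its expectation factorises (`IndepSeq.e_neg_prod`). This gives a second Borel–Cantelli lemma.
If the Choquet integral is infinite, then for every `M` the variable `|X n|` exceeds a multiple of
`M * n` infinitely often with capacity one, which is incompatible with bounded averages.

Attainment (c). Two events of capacity one may have an intersection of smaller capacity, so both
extremes must be produced in one event. Two consecutive blocks, of lengths `k` and `k ^ 2`, are
given a large and a small average by a single test variable: one minus two squared positive parts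
(`IndepSeq.cap_two_blocks_ge`). The capacity tends to one, and continuity from above yields
infinitely many such `k` with capacity one. The upper law applied to `(|X| - N)⁺` removes the
truncation. The same remainder estimate gives `X n / n → 0` off a null set, so increments of the
averages vanish and every intermediate value is a cluster point. -/

/-! ### Calculus of bounded Lipschitz functions. -/

/-- Bounded Lipschitz functions. -/
structure BLip {E : Type*} [NormedAddCommGroup E] (f : E → ℝ) : Prop where
  bdd : ∃ K : ℝ, 0 ≤ K ∧ ∀ x, |f x| ≤ K
  lip : ∃ L : ℝ, 0 ≤ L ∧ ∀ x y, |f x - f y| ≤ L * ‖x - y‖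

namespace BLip

variable {E F : Type*} [NormedAddCommGroup E] [NormedAddCommGroup F] {f g : E → ℝ}

lemma locLip (hf : BLip f) : LocLip f := by
  obtain ⟨L, hL, h⟩ := hf.lip
  refine ⟨L + 1, by linarith, 0, fun x y => (h x y).trans ?_⟩
  have := norm_nonneg (x - y)
  simp only [pow_zero]
  nlinarith

lemma const (c : ℝ) : BLip (fun _ : E => c) :=
  ⟨⟨|c|, abs_nonneg c, fun _ => le_rfl⟩, ⟨0, le_rfl, fun _ _ => by simp⟩⟩

lemma comp_lip (hf : BLip f) {u : F → E} {L : ℝ} (hL : 0 ≤ L)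
    (hu : ∀ x y, ‖u x - u y‖ ≤ L * ‖x - y‖) : BLip (fun x => f (u x)) := by
  obtain ⟨K, hK, h⟩ := hf.bdd
  obtain ⟨M, hM, h'⟩ := hf.lip
  refine ⟨⟨K, hK, fun x => h _⟩, ⟨M * L, by positivity, fun x y => (h' _ _).trans ?_⟩⟩
  rw [mul_assoc]
  exact mul_le_mul_of_nonneg_left (hu x y) hM

/-- Composition of a Lipschitz function after a bounded Lipschitz one. -/
lemma lip_comp (hf : BLip f) {u : ℝ → ℝ} {L : ℝ} (hL : 0 ≤ L)
    (hu : ∀ x y, |u x - u y| ≤ L * |x - y|) : BLip (fun x => u (f x)) := by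
  obtain ⟨K, hK, h⟩ := hf.bdd
  obtain ⟨M, hM, h'⟩ := hf.lip
  refine ⟨⟨|u 0| + L * K, by positivity, fun x => ?_⟩,
    ⟨L * M, by positivity, fun x y => (hu _ _).trans ?_⟩⟩
  · have h1 := hu (f x) 0
    have h2 := abs_sub_abs_le_abs_sub (u (f x)) (u 0)
    rw [sub_zero] at h1
    have := mul_le_mul_of_nonneg_left (h x) hL
    linarith
  · rw [mul_assoc]
    exact mul_le_mul_of_nonneg_left (h' x y) hL

lemma add (hf : BLip f) (hg : BLip g) : BLip (fun x => f x + g x) := by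
  obtain ⟨K, hK, h1⟩ := hf.bdd
  obtain ⟨M, hM, h2⟩ := hf.lip
  obtain ⟨K', hK', h3⟩ := hg.bdd
  obtain ⟨M', hM', h4⟩ := hg.lip
  refine ⟨⟨K + K', by positivity, fun x => (abs_add_le _ _).trans (add_le_add (h1 x) (h3 x))⟩,
    ⟨M + M', by positivity, fun x y => ?_⟩⟩
  rw [add_sub_add_comm, add_mul]
  exact (abs_add_le _ _).trans (add_le_add (h2 x y) (h4 x y))

lemma mul (hf : BLip f) (hg : BLip g) : BLip (fun x => f x * g x) := by
  obtain ⟨K, hK, h1⟩ := hf.bdd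
  obtain ⟨M, hM, h2⟩ := hf.lip
  obtain ⟨K', hK', h3⟩ := hg.bdd
  obtain ⟨M', hM', h4⟩ := hg.lip
  refine ⟨⟨K * K', by positivity, fun x => ?_⟩, ⟨K * M' + M * K', by positivity, fun x y => ?_⟩⟩
  · rw [abs_mul]
    exact mul_le_mul (h1 x) (h3 x) (abs_nonneg _) hK
  · have : f x * g x - f y * g y = f x * (g x - g y) + (f x - f y) * g y := by ring
    rw [this]
    refine (abs_add_le _ _).trans ?_
    rw [abs_mul, abs_mul]
    have a1 := mul_le_mul (h1 x) (h4 x y) (abs_nonneg _) hK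
    have a2 := mul_le_mul (h2 x y) (h3 y) (abs_nonneg _) (by positivity)
    linarith

lemma neg (hf : BLip f) : BLip (fun x => -f x) := by
  simpa using (const (E := E) (-1)).mul hf

lemma sub (hf : BLip f) (hg : BLip g) : BLip (fun x => f x - g x) := by
  simpa [sub_eq_add_neg] using hf.add hg.neg

lemma abs (hf : BLip f) : BLip (fun x => |f x|) :=
  hf.lip_comp zero_le_one fun x y => by simpa using abs_abs_sub_abs_le_abs_sub x y

lemma max_zero (hf : BLip f) : BLip (fun x => max (f x) 0) :=
  hf.lip_comp zero_le_one fun x y => by simpa using abs_max_sub_max_le_abs x y 0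

lemma sq (hf : BLip f) : BLip (fun x => f x ^ 2) := by
  simpa [pow_two] using hf.mul hf

lemma sum {ι : Type*} (s : Finset ι) {f : ι → E → ℝ} (hf : ∀ i ∈ s, BLip (f i)) :
    BLip (fun x => ∑ i ∈ s, f i x) := by
  classical
  induction s using Finset.induction_on with
  | empty => simpa using const 0
  | insert a s ha ih =>
    simp only [Finset.sum_insert ha]
    exact (hf a (by simp)).add (ih fun i hi => hf i (by simp [hi]))

/-- Truncation of a Lipschitz function. -/
lemma clamp {u : E → ℝ} {L : ℝ} (hL : 0 ≤ L) (hu : ∀ x y, |u x - u y| ≤ L * ‖x - y‖)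
    (a b : ℝ) : BLip (fun x => max a (min (u x) b)) := by
  refine ⟨⟨|a| + |b|, by positivity, fun x => ?_⟩, ⟨L, hL, fun x y => ?_⟩⟩
  · rw [abs_le]
    constructor
    · have := neg_abs_le a
      have := le_max_left a (min (u x) b)
      have := abs_nonneg b
      linarith
    · refine max_le ?_ ((min_le_right _ _).trans ?_)
      · have := le_abs_self a
        have := abs_nonneg b
        linarith
      · have := le_abs_self b
        have := abs_nonneg a
        linarith
  · refine le_trans ?_ (hu x y)
    refine le_trans (abs_max_sub_max_le_max _ _ _ _) ?_
    refine max_le (by simp) ((abs_min_sub_min_le_max _ _ _ _).trans (max_le le_rfl (by simp)))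

end BLip

/-! ### Bounded random variables and the real-valued expectation. -/

namespace SublinExpSpace

variable {Ω : Type*} [MeasurableSpace Ω]

/-- Bounded members of `H`. -/
def Bdd (S : SublinExpSpace Ω) (U : Ω → ℝ) : Prop := U ∈ S.H ∧ ∃ K : ℝ, ∀ ω, |U ω| ≤ K

/-- The sub-linear expectation as a real number. -/
noncomputable def e (S : SublinExpSpace Ω) (U : Ω → ℝ) : ℝ := (S.E U).toReal

variable {S : SublinExpSpace Ω} {U W : Ω → ℝ}

lemma comp_mem_one (hU : U ∈ S.H) {φ : ℝ → ℝ} {L : ℝ} (hL : 0 ≤ L)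
    (h : ∀ x y, |φ x - φ y| ≤ L * |x - y|) : (fun ω => φ (U ω)) ∈ S.H := by
  refine S.comp_mem 1 (fun _ => U) (fun _ => hU) (fun x => φ (x 0)) ?_
  refine ⟨L + 1, by linarith, 0, fun x y => (h _ _).trans ?_⟩
  have h1 : |x 0 - y 0| ≤ ‖x - y‖ := by simpa using norm_le_pi_norm (x - y) 0
  have := abs_nonneg (x 0 - y 0)
  simp only [pow_zero]
  nlinarith

lemma const_mem (S : SublinExpSpace Ω) (c : ℝ) : (fun _ => c) ∈ S.H :=
  S.comp_mem 0 (fun i => i.elim0) (fun i => i.elim0) (fun _ => c) (BLip.const c).locLip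

lemma blip_mem {n : ℕ} {X : Fin n → Ω → ℝ} (hX : ∀ i, X i ∈ S.H) {φ : (Fin n → ℝ) → ℝ}
    (hφ : BLip φ) : (fun ω => φ (fun i => X i ω)) ∈ S.H :=
  S.comp_mem n X hX φ hφ.locLip

lemma add_mem (hU : U ∈ S.H) (hW : W ∈ S.H) : (fun ω => U ω + W ω) ∈ S.H := S.H.add_mem hU hW
lemma sub_mem (hU : U ∈ S.H) (hW : W ∈ S.H) : (fun ω => U ω - W ω) ∈ S.H := S.H.sub_mem hU hW
lemma neg_mem (hU : U ∈ S.H) : (fun ω => -U ω) ∈ S.H := S.H.neg_mem hU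
lemma abs_mem (hU : U ∈ S.H) : (fun ω => |U ω|) ∈ S.H :=
  comp_mem_one hU zero_le_one fun x y => by simpa using abs_abs_sub_abs_le_abs_sub x y
lemma max_mem (hU : U ∈ S.H) (c : ℝ) : (fun ω => max (U ω) c) ∈ S.H :=
  comp_mem_one (φ := fun x => max x c) hU zero_le_one
    fun x y => by simpa using abs_max_sub_max_le_abs x y c

lemma mul_mem (hU : U ∈ S.H) (hW : W ∈ S.H) : (fun ω => U ω * W ω) ∈ S.H := by
  refine S.comp_mem 2 ![U, W] (fun i => by fin_cases i <;> simpa) (fun x => x 0 * x 1) ?_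
  refine ⟨1, one_pos, 1, fun x y => ?_⟩
  have e1 : x 0 * x 1 - y 0 * y 1 = x 0 * (x 1 - y 1) + y 1 * (x 0 - y 0) := by ring
  have h0 : |x 0 - y 0| ≤ ‖x - y‖ := by simpa using norm_le_pi_norm (x - y) 0
  have h1 : |x 1 - y 1| ≤ ‖x - y‖ := by simpa using norm_le_pi_norm (x - y) 1
  have hx : |x 0| ≤ ‖x‖ := by simpa using norm_le_pi_norm x 0
  have hy : |y 1| ≤ ‖y‖ := by simpa using norm_le_pi_norm y 1
  rw [e1]
  refine (abs_add_le _ _).trans ?_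
  rw [abs_mul, abs_mul]
  have a1 := mul_le_mul hx h1 (abs_nonneg _) (norm_nonneg _)
  have a2 := mul_le_mul hy h0 (abs_nonneg _) (norm_nonneg _)
  have := norm_nonneg (x - y)
  simp only [pow_one, one_mul]
  nlinarith

namespace Bdd

lemma const (c : ℝ) : S.Bdd (fun _ => c) := ⟨S.const_mem c, |c|, fun _ => le_rfl⟩

lemma add (hU : S.Bdd U) (hW : S.Bdd W) : S.Bdd (fun ω => U ω + W ω) := by
  obtain ⟨h1, K, h2⟩ := hU
  obtain ⟨h3, M, h4⟩ := hW
  exact ⟨add_mem h1 h3, K + M, fun ω => (abs_add_le _ _).trans (add_le_add (h2 ω) (h4 ω))⟩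

lemma mul (hU : S.Bdd U) (hW : S.Bdd W) : S.Bdd (fun ω => U ω * W ω) := by
  obtain ⟨h1, K, h2⟩ := hU
  obtain ⟨h3, M, h4⟩ := hW
  refine ⟨mul_mem h1 h3, K * M, fun ω => ?_⟩
  rw [abs_mul]
  exact mul_le_mul (h2 ω) (h4 ω) (abs_nonneg _) ((abs_nonneg _).trans (h2 ω))

lemma smul (c : ℝ) (hU : S.Bdd U) : S.Bdd (fun ω => c * U ω) := (const c).mul hU

lemma neg (hU : S.Bdd U) : S.Bdd (fun ω => -U ω) := by simpa using hU.smul (-1)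

lemma sub (hU : S.Bdd U) (hW : S.Bdd W) : S.Bdd (fun ω => U ω - W ω) := by
  simpa [sub_eq_add_neg] using hU.add hW.neg

lemma sq (hU : S.Bdd U) : S.Bdd (fun ω => U ω ^ 2) := by simpa [pow_two] using hU.mul hU

lemma abs (hU : S.Bdd U) : S.Bdd (fun ω => |U ω|) :=
  ⟨abs_mem hU.1, hU.2.choose, fun ω => by simpa using hU.2.choose_spec ω⟩

lemma max_zero (hU : S.Bdd U) : S.Bdd (fun ω => max (U ω) 0) := by
  obtain ⟨h1, K, h2⟩ := hU
  refine ⟨max_mem h1 0, K, fun ω => ?_⟩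
  rw [abs_of_nonneg (le_max_right _ _)]
  exact max_le ((le_abs_self _).trans (h2 ω)) ((abs_nonneg _).trans (h2 ω))

lemma sum {ι : Type*} (s : Finset ι) {f : ι → Ω → ℝ} (hf : ∀ i ∈ s, S.Bdd (f i)) :
    S.Bdd (fun x => ∑ i ∈ s, f i x) := by
  classical
  induction s using Finset.induction_on with
  | empty => simpa using const (S := S) 0
  | insert a s ha ih =>
    simp only [Finset.sum_insert ha]
    exact (hf a (by simp)).add (ih fun i hi => hf i (by simp [hi]))

lemma blip {g : ℝ → ℝ} (hg : BLip g) (hU : U ∈ S.H) : S.Bdd (fun ω => g (U ω)) := by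
  obtain ⟨L, hL, h⟩ := hg.lip
  obtain ⟨K, -, h'⟩ := hg.bdd
  exact ⟨comp_mem_one hU hL h, K, fun ω => h' _⟩

lemma past {n : ℕ} {X : Fin n → Ω → ℝ} (hX : ∀ i, X i ∈ S.H) {φ : (Fin n → ℝ) → ℝ}
    (hφ : BLip φ) : S.Bdd (fun ω => φ (fun i => X i ω)) := by
  obtain ⟨K, -, h'⟩ := hφ.bdd
  exact ⟨blip_mem hX hφ, K, fun ω => h' _⟩

lemma coe_e (hU : S.Bdd U) : ((S.e U : ℝ) : EReal) = S.E U := by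
  obtain ⟨h1, K, h2⟩ := hU
  refine EReal.coe_toReal ?_ ?_
  · have := S.mono _ (S.const_mem K) _ h1 (fun ω => (abs_le.1 (h2 ω)).2)
    rw [S.const] at this
    exact (this.trans_lt (EReal.coe_lt_top K)).ne
  · have := S.mono _ h1 _ (S.const_mem (-K)) (fun ω => (abs_le.1 (h2 ω)).1)
    rw [S.const] at this
    exact ((EReal.bot_lt_coe _).trans_le this).ne'

lemma lt_top (hU : S.Bdd U) : S.E U < ⊤ := hU.coe_e ▸ EReal.coe_lt_top _

end Bdd

lemma e_const (c : ℝ) : S.e (fun _ => c) = c := by rw [e, S.const, EReal.toReal_coe]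

lemma e_mono (hU : S.Bdd U) (hW : S.Bdd W) (h : ∀ ω, U ω ≤ W ω) : S.e U ≤ S.e W := by
  rw [← EReal.coe_le_coe_iff, hU.coe_e, hW.coe_e]
  exact S.mono _ hW.1 _ hU.1 h

lemma e_add_le (hU : S.Bdd U) (hW : S.Bdd W) : S.e (fun ω => U ω + W ω) ≤ S.e U + S.e W := by
  rw [← EReal.coe_le_coe_iff, EReal.coe_add, (hU.add hW).coe_e, hU.coe_e, hW.coe_e]
  apply S.subadd _ hU.1 _ hW.1
  · rw [← hU.coe_e]; simp
  · rw [← hU.coe_e]; simp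

lemma e_smul {c : ℝ} (hc : 0 ≤ c) (hU : S.Bdd U) : S.e (fun ω => c * U ω) = c * S.e U := by
  rw [← EReal.coe_eq_coe_iff, EReal.coe_mul, (hU.smul c).coe_e, hU.coe_e]
  exact S.pos_hom _ hU.1 c hc

/-- Constants pass through exactly, since sub-additivity may be applied with both `c` and `-c`. -/
lemma e_add_const (hU : S.Bdd U) (c : ℝ) : S.e (fun ω => U ω + c) = S.e U + c := by
  apply le_antisymm
  · simpa [e_const] using e_add_le hU (Bdd.const c)
  · have := e_add_le (hU.add (Bdd.const c)) (Bdd.const (S := S) (-c))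
    simp only [e_const, add_neg_cancel_right] at this
    linarith

lemma e_sub_le (hU : S.Bdd U) (hW : S.Bdd W) : S.e U - S.e W ≤ S.e (fun ω => U ω - W ω) := by
  have := e_add_le (hU.sub hW) hW
  simp only [sub_add_cancel] at this
  linarith

lemma e_le_const (hU : S.Bdd U) {c : ℝ} (h : ∀ ω, U ω ≤ c) : S.e U ≤ c := by
  simpa [e_const] using e_mono hU (Bdd.const c) h

lemma const_le_e (hU : S.Bdd U) {c : ℝ} (h : ∀ ω, c ≤ U ω) : c ≤ S.e U := by
  simpa [e_const] using e_mono (Bdd.const c) hU h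

lemma abs_e_sub_le (hU : S.Bdd U) (hW : S.Bdd W) {c : ℝ} (h : ∀ ω, |U ω - W ω| ≤ c) :
    |S.e U - S.e W| ≤ c := by
  rw [abs_le]
  have h1 := (e_sub_le hU hW).trans (e_le_const (hU.sub hW) fun ω => (abs_le.1 (h ω)).2)
  have h2 := (e_sub_le hW hU).trans
    (e_le_const (hW.sub hU) (c := c) fun ω => by have := (abs_le.1 (h ω)).1; linarith)
  constructor <;> linarith

/-! ### The upper capacity -/

/-- This Chebyshev-type comparison and its converse `le_cap` are the two basic bridges from
expectations to capacities. -/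
lemma cap_le (hU : S.Bdd U) {A : Set Ω} (h0 : ∀ ω, 0 ≤ U ω) (h : ∀ ω ∈ A, 1 ≤ U ω) :
    S.cap A ≤ ENNReal.ofReal (S.e U) := by
  rw [cap, ← EReal.real_coe_toENNReal, hU.coe_e]
  refine EReal.toENNReal_le_toENNReal (sInf_le ⟨U, ⟨hU.1, fun ω => ?_⟩, rfl⟩)
  by_cases hω : ω ∈ A
  · simpa [hω] using h ω hω
  · simpa [hω] using h0 ω

lemma le_cap (hU : S.Bdd U) {A : Set Ω} (h1 : ∀ ω, U ω ≤ 1) (h : ∀ ω, ω ∉ A → U ω ≤ 0) :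
    ENNReal.ofReal (S.e U) ≤ S.cap A := by
  rw [cap, ← EReal.real_coe_toENNReal, hU.coe_e]
  refine EReal.toENNReal_le_toENNReal (le_sInf ?_)
  rintro _ ⟨ξ, ⟨hξ, hξA⟩, rfl⟩
  refine S.mono _ hξ _ hU.1 fun ω => le_trans ?_ (hξA ω)
  by_cases hω : ω ∈ A
  · simpa [hω] using h1 ω
  · simpa [hω] using h ω hω

lemma cap_mono {A B : Set Ω} (h : A ⊆ B) : S.cap A ≤ S.cap B := by
  refine EReal.toENNReal_le_toENNReal (sInf_le_sInf (Set.image_mono ?_))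
  rintro ξ ⟨hξ, h'⟩
  refine ⟨hξ, fun ω => le_trans ?_ (h' ω)⟩
  exact Set.indicator_le_indicator_of_subset h (fun _ => zero_le_one) ω

lemma cap_le_one (A : Set Ω) : S.cap A ≤ 1 := by
  simpa [e_const] using cap_le (S := S) (A := A) (Bdd.const 1) (by simp) (by simp)

lemma cap_ne_top (A : Set Ω) : S.cap A ≠ ⊤ := ((cap_le_one A).trans_lt ENNReal.one_lt_top).ne

lemma cap_univ : S.cap Set.univ = 1 := by
  refine le_antisymm (cap_le_one _) ?_
  simpa [e_const] using le_cap (S := S) (A := Set.univ) (Bdd.const 1) (by simp) (by simp)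

lemma cap_empty : S.cap ∅ = 0 := by
  simpa [e_const] using cap_le (S := S) (A := ∅) (Bdd.const 0) (by simp) (by simp)

/-- Cutting a competitor `ξ` off at `1` keeps it admissible and does not raise its expectation, so
bounded competitors suffice in the infimum. -/
lemma exists_bdd_cap (A : Set Ω) {ε : ℝ} (hε : 0 < ε) :
    ∃ U, S.Bdd U ∧ (∀ ω, 0 ≤ U ω) ∧ (∀ ω ∈ A, 1 ≤ U ω) ∧ S.e U ≤ (S.cap A).toReal + ε := by
  set s := sInf (S.E '' {ξ | ξ ∈ S.H ∧ ∀ ω, A.indicator (fun _ => (1 : ℝ)) ω ≤ ξ ω}) with hs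
  have hs0 : 0 ≤ s := by
    refine le_sInf ?_
    rintro _ ⟨ξ, ⟨hξ, hξA⟩, rfl⟩
    have := S.mono _ hξ _ (S.const_mem 0)
      (fun ω => (Set.indicator_nonneg (fun _ _ => zero_le_one) ω).trans (hξA ω))
    rwa [S.const] at this
  have hcap : S.cap A = s.toENNReal := rfl
  have hsr : s = ((S.cap A).toReal : EReal) := by
    rw [hcap, EReal.toReal_toENNReal hs0, EReal.coe_toReal]
    · intro h
      exact cap_ne_top (S := S) A (by rw [hcap, h]; rfl)
    · exact (lt_of_lt_of_le (by simp) hs0).ne'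
  have hlt : s < (((S.cap A).toReal + ε : ℝ) : EReal) := by
    rw [hsr, EReal.coe_lt_coe_iff]; linarith
  obtain ⟨_, ⟨ξ, ⟨hξ, hξA⟩, rfl⟩, hlt⟩ := sInf_lt_iff.1 hlt
  have hξ0 : ∀ ω, 0 ≤ ξ ω :=
    fun ω => (Set.indicator_nonneg (fun _ _ => zero_le_one) ω).trans (hξA ω)
  have hmem : (fun ω => min (ξ ω) 1) ∈ S.H :=
    comp_mem_one (φ := fun x => min x 1) hξ zero_le_one
      fun x y => by simpa using abs_min_sub_min_le_max x 1 y 1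
  have hb : S.Bdd (fun ω => min (ξ ω) 1) := by
    refine ⟨hmem, 1, fun ω => ?_⟩
    rw [abs_of_nonneg (le_min (hξ0 ω) zero_le_one)]
    exact min_le_right _ _
  refine ⟨_, hb, fun ω => le_min (hξ0 ω) zero_le_one, fun ω hω => le_min ?_ le_rfl, ?_⟩
  · simpa [hω] using hξA ω
  · rw [← EReal.coe_le_coe_iff, hb.coe_e]
    exact (S.mono _ hξ _ hmem fun ω => min_le_left _ _).trans hlt.le

lemma cap_union_le (A B : Set Ω) : S.cap (A ∪ B) ≤ S.cap A + S.cap B := by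
  have key : (S.cap (A ∪ B)).toReal ≤ (S.cap A).toReal + (S.cap B).toReal := by
    refine le_of_forall_pos_le_add fun ε hε => ?_
    obtain ⟨U, hU, hU0, hU1, hUe⟩ := exists_bdd_cap (S := S) A (half_pos hε)
    obtain ⟨W, hW, hW0, hW1, hWe⟩ := exists_bdd_cap (S := S) B (half_pos hε)
    have h1 := cap_le (hU.add hW) (A := A ∪ B) (fun ω => add_nonneg (hU0 ω) (hW0 ω)) (by
      rintro ω (h | h)
      · have := hU1 ω h; have := hW0 ω; linarith
      · have := hW1 ω h; have := hU0 ω; linarith)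
    have h2 := ENNReal.toReal_mono ENNReal.ofReal_ne_top h1
    rw [ENNReal.toReal_ofReal
      (const_le_e (hU.add hW) fun ω => add_nonneg (hU0 ω) (hW0 ω))] at h2
    have := e_add_le hU hW
    linarith
  rw [← ENNReal.toReal_add (cap_ne_top _) (cap_ne_top _)] at key
  exact (ENNReal.toReal_le_toReal (cap_ne_top _)
    (ENNReal.add_ne_top.2 ⟨cap_ne_top _, cap_ne_top _⟩)).1 key

/-- Sub-additivity allows null sets to be discarded. This substitutes for intersecting events of
capacity one, which is not available for an upper capacity. -/
lemma cap_eq_one_of_diff_null {A N B : Set Ω} (hA : S.cap A = 1) (hN : S.cap N = 0)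
    (h : ∀ ω ∈ A, ω ∉ N → ω ∈ B) : S.cap B = 1 := by
  refine le_antisymm (cap_le_one _) ?_
  rw [← hA, ← add_zero (S.cap B), ← hN]
  refine (cap_mono fun ω hω => ?_).trans (cap_union_le B N)
  by_cases hn : ω ∈ N
  · exact Or.inr hn
  · exact Or.inl (h ω hω hn)

/-- The Borel–Cantelli lemma. -/
lemma cap_limsup_eq_zero (hV : CountablySubadditive S.cap) {A : ℕ → Set Ω}
    (hA : ∀ n, MeasurableSet (A n)) (hs : ∑' n, S.cap (A n) ≠ ⊤) :
    S.cap {ω | ∃ᶠ n in atTop, ω ∈ A n} = 0 := by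
  refine le_antisymm ?_ bot_le
  refine ge_of_tendsto' (ENNReal.tendsto_sum_nat_add (fun n => S.cap (A n)) hs) fun k => ?_
  refine (cap_mono fun ω hω => ?_).trans (hV (fun n => A (n + k)) fun n => hA _)
  obtain ⟨n, hn, h⟩ := frequently_atTop.1 hω k
  exact Set.mem_iUnion.2 ⟨n - k, by simpa [Nat.sub_add_cancel hn] using h⟩

lemma cap_iUnion_eq_zero (hV : CountablySubadditive S.cap) {A : ℕ → Set Ω}
    (hA : ∀ n, MeasurableSet (A n)) (h : ∀ n, S.cap (A n) = 0) : S.cap (⋃ n, A n) = 0 := by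
  refine le_antisymm ((hV A hA).trans ?_) bot_le
  simp [h]

lemma countablySubadditive_of_continuous (hV : ContinuousCapacity S.cap) :
    CountablySubadditive S.cap := by
  intro A hA
  have h1 := hV.1 (fun n => ⋃ i ∈ Finset.range n, A i)
    (fun n => Finset.measurableSet_biUnion _ fun i _ => hA i) (by
      intro m n hmn
      exact Set.biUnion_subset_biUnion_left fun i hi =>
        Finset.mem_range.2 ((Finset.mem_range.1 hi).trans_le hmn))
  have h2 : ⋃ n, ⋃ i ∈ Finset.range n, A i = ⋃ n, A n := by
    ext ω
    simp only [Set.mem_iUnion, Finset.mem_range, exists_prop]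
    exact ⟨fun ⟨_, i, _, h⟩ => ⟨i, h⟩, fun ⟨i, h⟩ => ⟨i + 1, i, Nat.lt_succ_self i, h⟩⟩
  rw [h2] at h1
  refine le_of_tendsto' h1 fun n => ?_
  refine le_trans ?_ (ENNReal.sum_le_tsum (Finset.range n))
  induction n with
  | zero => simp [cap_empty]
  | succ n ih =>
    rw [Finset.sum_range_succ, Finset.range_add_one, Finset.set_biUnion_insert, Set.union_comm]
    exact (cap_union_le _ _).trans (add_le_add ih le_rfl)

/-- If the events `A n` have capacities tending to one, so has their upper limit. -/
lemma cap_frequently_eq_one (hV : ContinuousCapacity S.cap) {A : ℕ → Set Ω}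
    (hA : ∀ n, MeasurableSet (A n)) (h : ∀ k, S.cap (⋃ n, A (n + k)) = 1) :
    S.cap {ω | ∃ᶠ n in atTop, ω ∈ A n} = 1 := by
  -- The upper limit is the decreasing intersection of the tail unions, so continuity from above
  -- keeps the value one.
  have h1 := hV.2 (fun k => ⋃ n, A (n + k)) (fun k => MeasurableSet.iUnion fun n => hA _) (by
    intro k l hkl ω hω
    obtain ⟨n, hn⟩ := Set.mem_iUnion.1 hω
    refine Set.mem_iUnion.2 ⟨n + (l - k), ?_⟩
    rwa [add_assoc, Nat.sub_add_cancel hkl])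
  simp only [h] at h1
  rw [← tendsto_nhds_unique h1 tendsto_const_nhds]
  congr 1
  ext ω
  simp only [Set.mem_ofPred_eq, Set.mem_iInter, Set.mem_iUnion, frequently_atTop]
  refine forall_congr' fun k => ⟨fun ⟨n, hn, h⟩ => ⟨n - k, by rwa [Nat.sub_add_cancel hn]⟩,
    fun ⟨n, h⟩ => ⟨n + k, by omega, h⟩⟩

end SublinExpSpace

/-! ### Truncations, cut-offs and elementary inequalities. -/

/-- The truncation of a real number to `[-c, c]`. -/
noncomputable def clamp (c x : ℝ) : ℝ := max (-c) (min x c)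

/-- A Lipschitz function between the indicators of `r ≤ |x|` and of `r / 2 ≤ |x|`. -/
noncomputable def bump (r x : ℝ) : ℝ := max 0 (min (2 * |x| / r - 1) 1)

lemma blip_clamp (c : ℝ) : BLip (clamp c) :=
  BLip.clamp (u := fun x : ℝ => x) zero_le_one (by simp) _ _

lemma clamp_mono (c : ℝ) : Monotone (clamp c) := fun _ _ h =>
  max_le_max le_rfl (min_le_min h le_rfl)

lemma abs_clamp_le {c : ℝ} (hc : 0 ≤ c) (x : ℝ) : |clamp c x| ≤ c :=
  abs_le.2 ⟨le_max_left _ _, max_le (by linarith) (min_le_right _ _)⟩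

lemma clamp_eq {c x : ℝ} (h : |x| ≤ c) : clamp c x = x := by
  have := abs_le.1 h
  rw [clamp, min_eq_left this.2, max_eq_right this.1]

lemma abs_sub_clamp {c : ℝ} (hc : 0 ≤ c) (x : ℝ) : |x - clamp c x| = max (|x| - c) 0 := by
  rcases le_total |x| c with h | h
  · rw [clamp_eq h, max_eq_right (by linarith)]; simp
  · rw [max_eq_left (by linarith), clamp]
    rcases le_total 0 x with hx | hx
    · rw [abs_of_nonneg hx] at h ⊢
      rw [min_eq_right h, max_eq_right (by linarith), abs_of_nonneg (by linarith)]
    · rw [abs_of_nonpos hx] at h ⊢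
      rw [min_eq_left (by linarith), max_eq_left (by linarith), abs_of_nonpos (by linarith)]
      ring

lemma clamp_neg {c : ℝ} (hc : 0 ≤ c) (x : ℝ) : clamp c (-x) = -clamp c x := by
  unfold clamp
  rcases le_total x c with h | h <;> rcases le_total (-c) x with h' | h'
  · rw [min_eq_left (by linarith), min_eq_left h, max_eq_right (by linarith), max_eq_right h']
  · rw [min_eq_right (by linarith), min_eq_left h, max_eq_right (by linarith), max_eq_left h',
      neg_neg]
  · rw [min_eq_left (by linarith), min_eq_right h, max_eq_left (by linarith),
      max_eq_right (by linarith)]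
  · rw [min_eq_right (by linarith), min_eq_right h, max_eq_right (by linarith)]
    linarith

lemma blip_bump {r : ℝ} (hr : 0 < r) : BLip (bump r) := by
  refine BLip.clamp (u := fun x : ℝ => 2 * |x| / r - 1) (L := 2 / r) (by positivity) ?_ _ _
  intro x y
  have : 2 * |x| / r - 1 - (2 * |y| / r - 1) = 2 / r * (|x| - |y|) := by ring
  rw [this, abs_mul, abs_of_pos (by positivity : 0 < 2 / r)]
  exact mul_le_mul_of_nonneg_left (abs_abs_sub_abs_le_abs_sub x y) (by positivity)

lemma bump_nonneg (r x : ℝ) : 0 ≤ bump r x := le_max_left _ _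

lemma bump_le_one (r x : ℝ) : bump r x ≤ 1 := max_le zero_le_one (min_le_right _ _)

lemma bump_eq_one {r x : ℝ} (hr : 0 < r) (h : r ≤ |x|) : bump r x = 1 := by
  have : 1 ≤ 2 * |x| / r - 1 := by
    rw [le_sub_iff_add_le, le_div_iff₀ hr]; linarith
  rw [bump, min_eq_right this, max_eq_right zero_le_one]

lemma bump_eq_zero {r x : ℝ} (hr : 0 < r) (h : |x| ≤ r / 2) : bump r x = 0 := by
  have : 2 * |x| / r - 1 ≤ 0 := by
    rw [sub_nonpos, div_le_iff₀ hr]; linarith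
  rw [bump, max_eq_left ((min_le_left _ _).trans this)]

lemma bump_mono {r x y : ℝ} (hr : 0 < r) (h : |x| ≤ |y|) : bump r x ≤ bump r y := by
  unfold bump
  gcongr

/-- Doubling the truncation level costs only a tail term. After division by the level this is the
recursion solved by `summable_of_le_half_add`. -/
lemma clamp_sq_le {c : ℝ} (hc : 0 < c) (x : ℝ) :
    clamp (2 * c) x ^ 2 ≤ clamp c x ^ 2 + 4 * c ^ 2 * bump c x := by
  rcases le_total |x| c with h | h
  · rw [clamp_eq h, clamp_eq (by linarith)]
    have := bump_nonneg c x
    have : 0 ≤ 4 * c ^ 2 * bump c x := by positivity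
    linarith
  · rw [bump_eq_one hc h]
    have := abs_clamp_le (by linarith : 0 ≤ 2 * c) x
    have := sq_le_sq' (abs_le.1 this).1 (abs_le.1 this).2
    nlinarith [sq_nonneg (clamp c x)]

lemma summable_of_le_half_add {u v : ℕ → ℝ} (hu : ∀ n, 0 ≤ u n) (hv : Summable v)
    (hv0 : ∀ n, 0 ≤ v n) (h : ∀ n, u (n + 1) ≤ u n / 2 + v n) : Summable u := by
  refine summable_of_sum_range_le (c := 2 * (u 0 + ∑' n, v n)) hu fun n => ?_
  have h1 : ∑ i ∈ Finset.range (n + 1), u i ≤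
      u 0 + ((∑ i ∈ Finset.range n, u i) / 2 + ∑ i ∈ Finset.range n, v i) := by
    rw [Finset.sum_range_succ', add_comm, Finset.sum_div, ← Finset.sum_add_distrib]
    exact add_le_add le_rfl (Finset.sum_le_sum fun i _ => h i)
  have h2 := hv.sum_le_tsum (Finset.range n) fun i _ => hv0 i
  rw [Finset.sum_range_succ] at h1
  have := hu n
  linarith

/-- Using the positive part makes the factor of `y` in the cross term nonnegative and non-decreasing
in `s`, as negative dependence requires. -/
lemma sq_max_add_le (s y : ℝ) : max (s + y) 0 ^ 2 ≤ max s 0 ^ 2 + 2 * (max s 0 * y) + y ^ 2 := by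
  rcases le_total s 0 with hs | hs
  · rw [max_eq_right hs]
    rcases le_total (s + y) 0 with h | h
    · rw [max_eq_right h]; nlinarith [sq_nonneg y]
    · rw [max_eq_left h]; nlinarith
  · rw [max_eq_left hs]
    rcases le_total (s + y) 0 with h | h
    · rw [max_eq_right h]; nlinarith [sq_nonneg (s + y)]
    · rw [max_eq_left h]; nlinarith

/-! ### Tame sequences and the second moment inequality. -/

namespace SublinExpSpace

variable {Ω : Type*} [MeasurableSpace Ω] {S : SublinExpSpace Ω} {X : ℕ → Ω → ℝ}

/-- Negative dependence, tested on the covariance of a nonnegative function of the past with a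
centred function of the present, both bounded, Lipschitz and non-decreasing. -/
def WeakNegDep (S : SublinExpSpace Ω) (X : ℕ → Ω → ℝ) : Prop :=
  ∀ (n : ℕ) (F : (Fin n → ℝ) → ℝ) (h : ℝ → ℝ), BLip F → BLip h → Monotone F → Monotone h →
    (∀ x, 0 ≤ F x) → S.e (fun ω => h (X n ω)) = 0 →
    S.e (fun ω => F (fun k => X k ω) * h (X n ω)) ≤ 0

/-- The assumptions on the common distribution of a sequence used in the law of large numbers. -/
structure Tame (S : SublinExpSpace Ω) (X : ℕ → Ω → ℝ) : Prop where
  mem : ∀ n, X n ∈ S.H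
  ident : ∀ (n : ℕ) (g : ℝ → ℝ), BLip g → S.e (fun ω => g (X n ω)) = S.e (fun ω => g (X 0 ω))
  tail : Summable fun j : ℕ => 2 ^ j * S.e (fun ω => bump (2 ^ j) (X 0 ω))
  ui : Tendsto (fun c : ℝ => S.E (fun ω => max (|X 0 ω| - c) 0)) atTop (𝓝 0)

lemma WeakNegDep.comp (hX : S.WeakNegDep X) {u : ℝ → ℝ} (hu : Monotone u)
    (hl : ∀ x y, |u x - u y| ≤ |x - y|) : S.WeakNegDep (fun n ω => u (X n ω)) := by
  intro n F h hF hh hFm hhm hF0 he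
  refine hX n (fun x => F (fun k => u (x k))) (fun x => h (u x)) ?_ ?_ ?_ ?_ ?_ he
  · refine hF.comp_lip (u := fun x : Fin n → ℝ => fun k => u (x k)) zero_le_one fun x y => ?_
    rw [one_mul, pi_norm_le_iff_of_nonneg (norm_nonneg _)]
    intro k
    exact (hl _ _).trans (by simpa using norm_le_pi_norm (x - y) k)
  · exact hh.comp_lip zero_le_one fun x y => by simpa using hl x y
  · exact fun x y hxy => hFm fun k => hu (hxy k)
  · exact fun x y hxy => hhm (hu hxy)
  · exact fun x => hF0 _

lemma max_sub_mem {U : Ω → ℝ} (hU : U ∈ S.H) (c : ℝ) : (fun ω => max (|U ω| - c) 0) ∈ S.H :=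
  max_mem (sub_mem (abs_mem hU) (S.const_mem c)) 0

lemma Tame.comp (hX : S.Tame X) {u : ℝ → ℝ} (hl : ∀ x y, |u x - u y| ≤ |x - y|)
    (h0 : ∀ x, |u x| ≤ |x|) : S.Tame (fun n ω => u (X n ω)) where
  mem n := comp_mem_one (hX.mem n) zero_le_one (by simpa using hl)
  ident n g hg := hX.ident n (fun x => g (u x))
    (hg.comp_lip zero_le_one fun x y => by simpa using hl x y)
  tail := by
    have hm : u ∘ X 0 ∈ S.H := comp_mem_one (hX.mem 0) zero_le_one (by simpa using hl)
    refine hX.tail.of_nonneg_of_le (fun j => ?_) (fun j => ?_)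
    · exact mul_nonneg (by positivity)
        (const_le_e (Bdd.blip (blip_bump (by positivity)) hm) fun ω => bump_nonneg _ _)
    · refine mul_le_mul_of_nonneg_left ?_ (by positivity)
      exact e_mono (Bdd.blip (blip_bump (by positivity)) hm)
        (Bdd.blip (blip_bump (by positivity)) (hX.mem 0))
        fun ω => bump_mono (by positivity) (h0 _)
  ui := by
    have hm : u ∘ X 0 ∈ S.H := comp_mem_one (hX.mem 0) zero_le_one (by simpa using hl)
    refine tendsto_of_tendsto_of_tendsto_of_le_of_le tendsto_const_nhds hX.ui
      (fun c => ?_) (fun c => ?_)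
    · have := S.mono _ (max_sub_mem hm c) _ (S.const_mem 0) fun ω => le_max_right _ _
      rwa [S.const] at this
    · refine S.mono _ (max_sub_mem (hX.mem 0) c) _ (max_sub_mem hm c) fun ω => ?_
      exact max_le_max (sub_le_sub_right (h0 _) _) le_rfl

lemma Tame.neg (hX : S.Tame X) : S.Tame (fun n ω => -X n ω) :=
  hX.comp (u := fun x => -x) (fun x y => by rw [← abs_neg]; ring_nf; rfl) (by simp)

lemma coe_e_of_abs {U : Ω → ℝ} (hU : U ∈ S.H) (h : S.E (fun ω => |U ω|) < ⊤) :
    ((S.e U : ℝ) : EReal) = S.E U := by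
  have h1 := (S.mono _ (abs_mem hU) _ hU fun ω => le_abs_self _).trans_lt h
  have h2 := (S.mono _ (abs_mem hU) _ (neg_mem hU) fun ω => neg_le_abs _).trans_lt h
  refine EReal.coe_toReal h1.ne fun hb => ?_
  -- The value `-∞` is excluded because it would give `0 = E[U + (-U)] ≤ -∞`.
  have h3 := S.subadd _ hU _ (neg_mem hU) (by simp [hb]) (fun h => h2.ne h.2)
  simp only [add_neg_cancel, S.const, hb, EReal.bot_add] at h3
  simp at h3

lemma e_add_le_of_coe {U W : Ω → ℝ} (hU : U ∈ S.H) (hW : W ∈ S.H)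
    (cU : ((S.e U : ℝ) : EReal) = S.E U) (cW : ((S.e W : ℝ) : EReal) = S.E W)
    {a : ℝ} (ha : (a : EReal) ≤ S.E (fun ω => U ω + W ω)) : a ≤ S.e U + S.e W := by
  rw [← EReal.coe_le_coe_iff, EReal.coe_add, cU, cW]
  refine ha.trans (S.subadd _ hU _ hW ?_ ?_) <;> rw [← cU] <;> simp

lemma Tame.abs_lt_top (hX : S.Tame X) : S.E (fun ω => |X 0 ω|) < ⊤ := by
  obtain ⟨c, hc⟩ := (hX.ui.eventually (gt_mem_nhds (EReal.zero_lt_top))).exists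
  have hm := max_sub_mem (hX.mem 0) c
  have h0 := S.mono _ hm _ (S.const_mem 0) fun ω => le_max_right _ _
  rw [S.const] at h0
  have h1 := S.mono _ (add_mem hm (S.const_mem c)) _ (abs_mem (hX.mem 0)) fun ω => by
    have := le_max_left (|X 0 ω| - c) 0
    linarith
  have h2 := S.subadd _ hm _ (S.const_mem c) (by simp [S.const]) (by simp [S.const])
  refine (h1.trans h2).trans_lt ?_
  rw [S.const]
  exact EReal.add_lt_top hc.ne (EReal.coe_ne_top c)

lemma Tame.coe_e (hX : S.Tame X) : ((S.e (X 0) : ℝ) : EReal) = S.E (X 0) :=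
  coe_e_of_abs (hX.mem 0) hX.abs_lt_top

lemma Tame.rem_abs_lt_top (hX : S.Tame X) {c : ℝ} (hc : 0 ≤ c) :
    S.E (fun ω => |max (|X 0 ω| - c) 0|) < ⊤ := by
  refine lt_of_le_of_lt ?_ hX.abs_lt_top
  refine S.mono _ (abs_mem (hX.mem 0)) _ (abs_mem (max_sub_mem (hX.mem 0) c)) fun ω => ?_
  rw [abs_of_nonneg (le_max_right _ _)]
  exact max_le (by linarith) (abs_nonneg _)

lemma Tame.e_rem_tendsto (hX : S.Tame X) :
    Tendsto (fun c : ℝ => S.e (fun ω => max (|X 0 ω| - c) 0)) atTop (𝓝 0) := by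
  exact (EReal.tendsto_toReal EReal.zero_ne_top EReal.zero_ne_bot).comp hX.ui

/-- The truncation error is exactly `(|x| - c)⁺` in absolute value, so sub-additivity in both
directions gives the bound. -/
lemma Tame.abs_e_clamp_sub_le (hX : S.Tame X) {c : ℝ} (hc : 0 ≤ c) :
    |S.e (fun ω => clamp c (X 0 ω)) - S.e (X 0)| ≤ S.e (fun ω => max (|X 0 ω| - c) 0) := by
  have hr := max_sub_mem (hX.mem 0) c
  have cr := coe_e_of_abs hr (hX.rem_abs_lt_top hc)
  have hb : S.Bdd fun ω => clamp c (X 0 ω) := Bdd.blip (blip_clamp c) (hX.mem 0)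
  have hd := fun ω => abs_le.1 (abs_sub_clamp hc (X 0 ω)).le
  have h1 : S.e (fun ω => clamp c (X 0 ω)) ≤ _ :=
    e_add_le_of_coe (hX.mem 0) hr hX.coe_e cr (by
      rw [hb.coe_e]
      exact S.mono _ (add_mem (hX.mem 0) hr) _ hb.1 fun ω => by linarith [(hd ω).1])
  have h2 : S.e (X 0) ≤ _ :=
    e_add_le_of_coe hb.1 hr hb.coe_e cr (by
      rw [hX.coe_e]
      exact S.mono _ (add_mem hb.1 hr) _ (hX.mem 0) fun ω => by linarith [(hd ω).2])
  rw [abs_le]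
  constructor <;> linarith

lemma Tame.e_clamp_tendsto (hX : S.Tame X) :
    Tendsto (fun c : ℝ => S.e (fun ω => clamp c (X 0 ω))) atTop (𝓝 (S.e (X 0))) := by
  rw [tendsto_iff_dist_tendsto_zero]
  refine squeeze_zero' (Eventually.of_forall fun c => dist_nonneg) ?_ hX.e_rem_tendsto
  filter_upwards [eventually_ge_atTop 0] with c hc using hX.abs_e_clamp_sub_le hc

/-- The second moment inequality for positive parts of weighted centred sums. -/
lemma second_moment (hX : S.Tame X) (hW : S.WeakNegDep X) {g : ℝ → ℝ} (hg : BLip g)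
    (hm : Monotone g) (he : S.e (fun ω => g (X 0 ω)) = 0) {c : ℕ → ℝ} (hc : ∀ i, 0 ≤ c i)
    (n : ℕ) :
    S.e (fun ω => max (∑ i ∈ Finset.range n, c i * g (X i ω)) 0 ^ 2) ≤
      (∑ i ∈ Finset.range n, c i ^ 2) * S.e (fun ω => g (X 0 ω) ^ 2) := by
  have hgb : ∀ i, S.Bdd fun ω => g (X i ω) := fun i => Bdd.blip hg (hX.mem i)
  have hs : ∀ n, S.Bdd fun ω => max (∑ i ∈ Finset.range n, c i * g (X i ω)) 0 := fun n =>
    (Bdd.sum _ fun i _ => (hgb i).smul (c i)).max_zero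
  induction n with
  | zero => simp [e_const]
  | succ n ih =>
    -- The positive part of the past sum is non-decreasing because the weights are nonnegative, so
    -- the covariance condition removes the cross term.
    have hcov : S.e (fun ω =>
        max (∑ i ∈ Finset.range n, c i * g (X i ω)) 0 * g (X n ω)) ≤ 0 := by
      have hF : BLip fun x : Fin n → ℝ => ∑ i : Fin n, c i * g (x i) :=
        BLip.sum _ fun i _ => (BLip.const _).mul
          (hg.comp_lip zero_le_one fun x y => by simpa using norm_le_pi_norm (x - y) i)
      have := hW n (fun x => max (∑ i : Fin n, c i * g (x i)) 0) g hF.max_zero hg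
        (fun x y hxy => max_le_max (Finset.sum_le_sum fun i _ =>
          mul_le_mul_of_nonneg_left (hm (hxy i)) (hc i)) le_rfl) hm (fun x => le_max_right _ _)
        ((hX.ident n g hg).trans he)
      have hsum : ∀ ω, ∑ i : Fin n, c i * g (X i ω) = ∑ i ∈ Finset.range n, c i * g (X i ω) :=
        fun ω => Fin.sum_univ_eq_sum_range (fun i => c i * g (X i ω)) n
      simpa only [hsum] using this
    have hb1 := (hs n).sq
    have hb2 := ((hs n).mul (hgb n)).smul (2 * c n)
    have hb3 := (hgb n).sq.smul (c n ^ 2)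
    have h1 := e_mono (hs (n + 1)).sq ((hb1.add hb2).add hb3) fun ω => by
      rw [Finset.sum_range_succ]
      refine (sq_max_add_le _ _).trans (le_of_eq ?_)
      ring
    have h2 := e_add_le (hb1.add hb2) hb3
    have h3 := e_add_le hb1 hb2
    rw [e_smul (by have := hc n; positivity) ((hs n).mul (hgb n))] at h3
    rw [e_smul (by positivity) (hgb n).sq, hX.ident n (fun x => g x ^ 2) hg.sq] at h2
    rw [Finset.sum_range_succ, add_mul]
    have := mul_nonneg (by norm_num : (0 : ℝ) ≤ 2) (hc n)
    nlinarith

lemma sum_range_indicator_Ico (a r : ℕ) (f : ℕ → ℝ) :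
    ∑ i ∈ Finset.range (a + r), (if a ≤ i then (1 : ℝ) else 0) * f i =
      ∑ i ∈ Finset.Ico a (a + r), f i := by
  simp only [ite_mul, one_mul, zero_mul]
  rw [← Finset.sum_filter]
  congr 1
  ext i
  simp [and_comm]

/-- Chebyshev's inequality. Zero–one weights in `second_moment` select a block in the middle of the
sequence. -/
lemma cap_block_le (hX : S.Tame X) (hW : S.WeakNegDep X) {g : ℝ → ℝ} (hg : BLip g)
    (hm : Monotone g) (he : S.e (fun ω => g (X 0 ω)) = 0) (a r : ℕ) {x : ℝ} (hx : 0 < x) :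
    S.cap {ω | x ≤ ∑ i ∈ Finset.Ico a (a + r), g (X i ω)} ≤
      ENNReal.ofReal (r * S.e (fun ω => g (X 0 ω) ^ 2) / x ^ 2) := by
  have h := second_moment hX hW hg hm he (c := fun i => if a ≤ i then 1 else 0)
    (fun i => by positivity) (a + r)
  have hc : ∑ i ∈ Finset.range (a + r), (if a ≤ i then (1 : ℝ) else 0) ^ 2 = r := by
    have := sum_range_indicator_Ico a r fun _ => 1
    simp only [mul_one, Finset.sum_const, Nat.card_Ico, add_tsub_cancel_left, nsmul_eq_mul] at this
    rw [← this]
    exact Finset.sum_congr rfl fun i _ => by split_ifs <;> simp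
  rw [hc] at h
  simp only [sum_range_indicator_Ico a r fun i => g (X i _)] at h
  have hb : S.Bdd fun ω => max (∑ i ∈ Finset.Ico a (a + r), g (X i ω)) 0 ^ 2 :=
    (Bdd.sum _ fun i _ => Bdd.blip hg (hX.mem i)).max_zero.sq
  refine (cap_le (hb.smul (x ^ 2)⁻¹) (fun ω => by positivity) fun ω hω => ?_).trans
    (ENNReal.ofReal_le_ofReal ?_)
  · rw [inv_mul_eq_div, le_div_iff₀ (by positivity), one_mul]
    exact pow_le_pow_left₀ hx.le (le_max_of_le_left hω) 2
  · rw [e_smul (by positivity) hb, inv_mul_eq_div]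
    gcongr

end SublinExpSpace

/-! ### Dyadic blocks and the upper law of large numbers. -/

/-- Take `2 ^ l` to be the largest power of two below `n / M`. The mesh is then at most the fraction
`1 / M` of `n`, while only `2 * M` grid indices occur, a number independent of `n`. -/
lemma exists_dyadic_block {M n l₀ : ℕ} (hM0 : 0 < M) (hn : M * 2 ^ l₀ ≤ n) :
    ∃ l q, l₀ ≤ l ∧ q < 2 * M ∧ 2 ^ l * M ≤ n ∧ (q + 1) * 2 ^ l ≤ n ∧
      n < (q + 1) * 2 ^ l + 2 ^ l := by
  set l := Nat.log 2 (n / M)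
  have hnM : 2 ^ l₀ ≤ n / M := (Nat.le_div_iff_mul_le hM0).2 (by rwa [mul_comm])
  have hnM0 : n / M ≠ 0 := ne_of_gt (lt_of_lt_of_le (by positivity) hnM)
  have hll : l₀ ≤ l := (Nat.le_log_iff_pow_le one_lt_two hnM0).2 hnM
  have hl1 : 2 ^ l ≤ n / M := Nat.pow_log_le_self 2 hnM0
  have hl2 : n / M < 2 ^ (l + 1) := Nat.lt_pow_succ_log_self one_lt_two _
  have hl1' : 2 ^ l * M ≤ n := (Nat.le_div_iff_mul_le hM0).1 hl1
  have hl2' : n < 2 ^ (l + 1) * M := (Nat.div_lt_iff_lt_mul hM0).1 hl2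
  have hp : 0 < 2 ^ l := by positivity
  obtain ⟨q, hq⟩ : ∃ q, n / 2 ^ l = q + 1 := Nat.exists_eq_succ_of_ne_zero (by
    have : 1 ≤ n / 2 ^ l := (Nat.le_div_iff_mul_le hp).2 (by nlinarith)
    omega)
  have hq1 : (q + 1) * 2 ^ l ≤ n := by rw [← hq]; exact Nat.div_mul_le_self _ _
  have hq2 : n < (q + 1) * 2 ^ l + 2 ^ l := by
    have := Nat.lt_div_mul_add (a := n) hp
    rwa [hq] at this
  refine ⟨l, q, hll, ?_, hl1', hq1, hq2⟩
  have : (q + 1) * 2 ^ l < 2 * M * 2 ^ l := lt_of_le_of_lt hq1 (by rw [pow_succ] at hl2'; linarith)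
  have := lt_of_mul_lt_mul_right this (Nat.zero_le _)
  omega

namespace SublinExpSpace

variable {Ω : Type*} [MeasurableSpace Ω] {S : SublinExpSpace Ω} {X : ℕ → Ω → ℝ}

lemma measurableSet_frequently {A : ℕ → Set Ω} (hA : ∀ n, MeasurableSet (A n)) :
    MeasurableSet {ω | ∃ᶠ n in atTop, ω ∈ A n} := by
  have : {ω | ∃ᶠ n in atTop, ω ∈ A n} = ⋂ k, ⋃ n, A (n + k) := by
    ext ω
    simp only [Set.mem_ofPred_eq, Set.mem_iInter, Set.mem_iUnion, frequently_atTop]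
    exact forall_congr' fun k => ⟨fun ⟨n, hn, h⟩ => ⟨n - k, by rwa [Nat.sub_add_cancel hn]⟩,
      fun ⟨n, h⟩ => ⟨n + k, by omega, h⟩⟩
  rw [this]
  exact MeasurableSet.iInter fun k => MeasurableSet.iUnion fun n => hA _

lemma cap_frequently_eq_zero (hV : CountablySubadditive S.cap) {A : ℕ → Set Ω}
    (hA : ∀ n, MeasurableSet (A n)) {w : ℕ → ℝ} (hw : Summable w)
    (h : ∀ᶠ n in atTop, S.cap (A n) ≤ ENNReal.ofReal (w n)) :
    S.cap {ω | ∃ᶠ n in atTop, ω ∈ A n} = 0 := by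
  obtain ⟨k, hk⟩ := eventually_atTop.1 h
  have h1 : S.cap {ω | ∃ᶠ n in atTop, ω ∈ A (n + k)} = 0 := by
    refine cap_limsup_eq_zero hV (fun n => hA _) (ne_top_of_le_ne_top ?_
      (ENNReal.tsum_le_tsum fun n => hk (n + k) (Nat.le_add_left k n)))
    exact ((summable_nat_add_iff k).2 hw).tsum_ofReal_ne_top
  rw [← h1]
  congr 1
  ext ω
  simp only [Set.mem_ofPred_eq]
  rw [← frequently_map (m := fun n => n + k) (P := fun n => ω ∈ A n), map_add_atTop_eq_nat]

lemma e_sum_le {ι : Type*} (s : Finset ι) {f : ι → Ω → ℝ} (hf : ∀ i ∈ s, S.Bdd (f i)) :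
    S.e (fun ω => ∑ i ∈ s, f i ω) ≤ ∑ i ∈ s, S.e (f i) := by
  classical
  induction s using Finset.induction_on with
  | empty => simp [e_const]
  | insert a s ha ih =>
    simp only [Finset.sum_insert ha]
    have h := fun i hi => hf i (Finset.mem_insert_of_mem (b := a) hi)
    exact (e_add_le (hf a (by simp)) (Bdd.sum s h)).trans (add_le_add le_rfl (ih h))

lemma Tame.cap_exists_le (hX : S.Tame X) (s : Finset ℕ) {r : ℝ} (hr : 0 < r) :
    S.cap {ω | ∃ i ∈ s, r ≤ |X i ω|} ≤
      ENNReal.ofReal (s.card * S.e (fun ω => bump r (X 0 ω))) := by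
  have hb : ∀ i ∈ s, S.Bdd fun ω => bump r (X i ω) := fun i _ =>
    Bdd.blip (blip_bump hr) (hX.mem i)
  refine (cap_le (Bdd.sum s hb) (fun ω => Finset.sum_nonneg fun i _ => bump_nonneg _ _) ?_).trans
    (ENNReal.ofReal_le_ofReal ((e_sum_le s hb).trans (le_of_eq ?_)))
  · rintro ω ⟨i, hi, h⟩
    rw [← bump_eq_one hr h]
    exact Finset.single_le_sum (f := fun i => bump r (X i ω)) (fun i _ => bump_nonneg _ _) hi
  · rw [Finset.sum_congr rfl fun i _ => hX.ident i _ (blip_bump hr)]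
    simp

lemma Tame.summable_e_clamp_sq (hX : S.Tame X) :
    Summable fun l : ℕ => S.e (fun ω => clamp (2 ^ l) (X 0 ω) ^ 2) / 2 ^ l := by
  have hb : ∀ c : ℝ, S.Bdd fun ω => clamp c (X 0 ω) := fun c => Bdd.blip (blip_clamp c) (hX.mem 0)
  have hp : ∀ l : ℕ, S.Bdd fun ω => bump (2 ^ l) (X 0 ω) := fun l =>
    Bdd.blip (blip_bump (by positivity)) (hX.mem 0)
  refine summable_of_le_half_add
    (fun l => div_nonneg (const_le_e (hb _).sq fun ω => sq_nonneg _) (by positivity))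
    (hX.tail.mul_left 2)
    (fun l => mul_nonneg zero_le_two (mul_nonneg (by positivity)
      (const_le_e (hp l) fun ω => bump_nonneg _ _))) fun l => ?_
  have h1 := e_mono (hb (2 ^ (l + 1))).sq ((hb (2 ^ l)).sq.add ((hp l).smul (4 * (2 ^ l) ^ 2)))
    fun ω => by
      rw [pow_succ (2 : ℝ) l, mul_comm ((2 : ℝ) ^ l)]
      exact clamp_sq_le (by positivity) _
  have h2 := e_add_le (hb (2 ^ l)).sq ((hp l).smul (4 * (2 ^ l) ^ 2))
  rw [e_smul (by positivity) (hp l)] at h2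
  rw [div_le_iff₀ (by positivity)]
  refine (h1.trans h2).trans (le_of_eq ?_)
  rw [pow_succ (2 : ℝ) l]
  field_simp
  ring

/-- Block sums at geometric scales are asymptotically at most their expected size. -/
lemma cap_block_frequently (hV : CountablySubadditive S.cap) (hX : S.Tame X)
    (hW : S.WeakNegDep X) {r : ℕ} (hr : 0 < r) (a : ℕ → ℕ) {ε : ℝ} (hε : 0 < ε) :
    S.cap {ω | ∃ᶠ l in atTop, (r * 2 ^ l : ℝ) * (S.e (X 0) + ε) ≤
      ∑ i ∈ Finset.Ico (a l) (a l + r * 2 ^ l), X i ω} = 0 := by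
  set μ := S.e (X 0) with hμ
  set m : ℕ → ℝ := fun l => S.e fun ω => clamp (2 ^ l) (X 0 ω) with hm
  have hmt : Tendsto m atTop (𝓝 μ) :=
    hX.e_clamp_tendsto.comp (tendsto_pow_atTop_atTop_of_one_lt one_lt_two)
  set K := |μ| + 1
  refine cap_frequently_eq_zero hV (A := fun l => {ω | (r * 2 ^ l : ℝ) * (μ + ε) ≤
      ∑ i ∈ Finset.Ico (a l) (a l + r * 2 ^ l), X i ω}) (fun l => ?_)
    -- The first summand pays for some `|X i|` in the block reaching `2 ^ l`. The second is
    -- Chebyshev at half the margin: `(ε / 2)⁻² = 4 / ε ^ 2`, doubled by bounding the square of the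
    -- centred truncation by `2 * clamp ^ 2 + 2 * K ^ 2`.
    (w := fun l => r * (2 ^ l * S.e (fun ω => bump (2 ^ l) (X 0 ω))) +
      8 / ε ^ 2 * (S.e (fun ω => clamp (2 ^ l) (X 0 ω) ^ 2) / 2 ^ l + K ^ 2 * (1 / 2) ^ l)) ?_ ?_
  · exact measurableSet_le measurable_const
      (Finset.measurable_fun_sum _ fun i _ => S.measurable_of_mem _ (hX.mem i))
  · exact (hX.tail.mul_left _).add ((hX.summable_e_clamp_sq.add
      (summable_geometric_two.mul_left _)).mul_left _)
  · filter_upwards [hmt.eventually (gt_mem_nhds (by linarith : μ < μ + ε / 2)),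
      hmt.abs.eventually (gt_mem_nhds (by simp [K] : |μ| < K))] with l hl1 hl2
    set R : ℝ := r * 2 ^ l with hR
    have hr1 : (1 : ℝ) ≤ r := by exact_mod_cast hr
    have hR1 : (2 : ℝ) ^ l ≤ R := le_mul_of_one_le_left (by positivity) hr1
    have hR0 : 0 < R := lt_of_lt_of_le (by positivity) hR1
    have hb : S.Bdd fun ω => clamp (2 ^ l) (X 0 ω) := Bdd.blip (blip_clamp _) (hX.mem 0)
    set g : ℝ → ℝ := fun x => clamp (2 ^ l) x - m l with hg
    have hgb : BLip g := (blip_clamp _).sub (BLip.const _)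
    have hgm : Monotone g := fun x y h => sub_le_sub_right (clamp_mono _ h) _
    have hge : S.e (fun ω => g (X 0 ω)) = 0 := by
      have := e_add_const hb (-m l)
      simpa [hg, hm, sub_eq_add_neg] using this
    have hg2 : S.e (fun ω => g (X 0 ω) ^ 2) ≤
        2 * S.e (fun ω => clamp (2 ^ l) (X 0 ω) ^ 2) + 2 * K ^ 2 := by
      rw [← e_smul zero_le_two hb.sq, ← e_add_const (hb.sq.smul 2)]
      refine e_mono (Bdd.blip hgb (hX.mem 0)).sq ((hb.sq.smul 2).add (Bdd.const _)) fun ω => ?_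
      have : m l ^ 2 ≤ K ^ 2 := sq_le_sq' (abs_lt.1 hl2).1.le (abs_lt.1 hl2).2.le
      simp only [hg]
      nlinarith [sq_nonneg (clamp (2 ^ l) (X 0 ω) + m l)]
    have h1 := hX.cap_exists_le (Finset.Ico (a l) (a l + r * 2 ^ l))
      (r := 2 ^ l) (by positivity)
    have h2 := cap_block_le hX hW hgb hgm hge (a l) (r * 2 ^ l) (x := R * (ε / 2)) (by positivity)
    have hsub : {ω | R * (μ + ε) ≤ ∑ i ∈ Finset.Ico (a l) (a l + r * 2 ^ l), X i ω} ⊆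
        {ω | ∃ i ∈ Finset.Ico (a l) (a l + r * 2 ^ l), (2 : ℝ) ^ l ≤ |X i ω|} ∪
        {ω | R * (ε / 2) ≤ ∑ i ∈ Finset.Ico (a l) (a l + r * 2 ^ l), g (X i ω)} := by
      intro ω hω
      by_cases hex : ∃ i ∈ Finset.Ico (a l) (a l + r * 2 ^ l), (2 : ℝ) ^ l ≤ |X i ω|
      · exact Or.inl hex
      · refine Or.inr ?_
        push Not at hex
        have : ∑ i ∈ Finset.Ico (a l) (a l + r * 2 ^ l), g (X i ω) =
            ∑ i ∈ Finset.Ico (a l) (a l + r * 2 ^ l), X i ω - R * m l := by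
          simp only [hg, Finset.sum_sub_distrib]
          rw [Finset.sum_congr rfl fun i hi => clamp_eq (hex i hi).le]
          simp [hR]
        simp only [Set.mem_ofPred_eq] at hω ⊢
        rw [this]
        nlinarith
    refine (cap_mono hsub).trans ((cap_union_le _ _).trans ((add_le_add h1 h2).trans ?_))
    have hp0 : 0 ≤ S.e fun ω => bump (2 ^ l) (X 0 ω) :=
      const_le_e (Bdd.blip (blip_bump (by positivity)) (hX.mem 0)) fun ω => bump_nonneg _ _
    have hg0 : 0 ≤ S.e fun ω => g (X 0 ω) ^ 2 :=
      const_le_e (Bdd.blip hgb (hX.mem 0)).sq fun ω => sq_nonneg _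
    rw [← ENNReal.ofReal_add (by positivity) (by positivity)]
    refine ENNReal.ofReal_le_ofReal (add_le_add (le_of_eq ?_) ?_)
    · simp; ring
    · calc ((r * 2 ^ l : ℕ) : ℝ) * S.e (fun ω => g (X 0 ω) ^ 2) / (R * (ε / 2)) ^ 2
          = 4 / ε ^ 2 * (S.e (fun ω => g (X 0 ω) ^ 2) / R) := by
            push_cast; rw [← hR]; field_simp; norm_num
        _ ≤ 4 / ε ^ 2 * ((2 * S.e (fun ω => clamp (2 ^ l) (X 0 ω) ^ 2) + 2 * K ^ 2) / 2 ^ l) := by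
            gcongr
            exact hg0.trans hg2
        _ = _ := by rw [one_div, inv_pow]; field_simp; ring

/-- The upper half of the strong law of large numbers, for a fixed margin. -/
lemma cap_upper_frequently (hV : CountablySubadditive S.cap) (hX : S.Tame X)
    (hW : S.WeakNegDep X) {ε : ℝ} (hε : 0 < ε) :
    S.cap {ω | ∃ᶠ n : ℕ in atTop, n * (S.e (X 0) + ε) < ∑ i ∈ Finset.range n, X i ω} = 0 := by
  set Z : ℕ → Ω → ℝ := fun n ω => max (X n ω) 0 with hZ
  have hlip : ∀ x y : ℝ, |max x 0 - max y 0| ≤ |x - y| := fun x y => abs_max_sub_max_le_abs x y 0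
  have hZT : S.Tame Z := hX.comp hlip fun x => by
    rw [abs_of_nonneg (le_max_right _ _)]
    exact max_le (le_abs_self x) (abs_nonneg x)
  have hZW : S.WeakNegDep Z := hW.comp (u := fun x => max x 0)
    (fun x y h => max_le_max h le_rfl) hlip
  set μ := S.e (X 0)
  set ν := S.e (Z 0)
  have hν : 0 ≤ ν := EReal.toReal_nonneg (by
    have := S.mono _ (hZT.mem 0) _ (S.const_mem 0) fun ω => le_max_right _ _
    rwa [S.const] at this)
  -- One mesh length costs at most `2 ^ l * (|μ| + ν + 1)`: the last block of positive parts, plus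
  -- the change of `n * μ`. With `2 ^ l * M ≤ n` this is at most `n * ε / 2`.
  obtain ⟨M, hM⟩ := exists_nat_gt (2 * (|μ| + ν + 1) / ε)
  have hM0 : 0 < M := by
    have : (0 : ℝ) < M := lt_of_le_of_lt (by positivity) hM
    exact_mod_cast this
  -- `B q` concerns the sum up to the grid point, `C q` the following mesh interval with positive
  -- parts. The index `q + 1` keeps the first block nonempty.
  set B : ℕ → Set Ω := fun q => {ω | ∃ᶠ l in atTop, ((q + 1 : ℕ) * 2 ^ l : ℝ) * (μ + ε / 2) ≤
      ∑ i ∈ Finset.Ico ((fun _ => 0) l) ((fun _ => 0) l + (q + 1) * 2 ^ l), X i ω} with hB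
  set C : ℕ → Set Ω := fun q => {ω | ∃ᶠ l in atTop, ((1 : ℕ) * 2 ^ l : ℝ) * (ν + 1) ≤
      ∑ i ∈ Finset.Ico ((fun l => (q + 1) * 2 ^ l) l) ((fun l => (q + 1) * 2 ^ l) l + 1 * 2 ^ l),
        Z i ω} with hC
  have hms : ∀ (s : Finset ℕ) (Y : ℕ → Ω → ℝ), S.Tame Y → Measurable fun ω => ∑ i ∈ s, Y i ω :=
    fun s Y hY => Finset.measurable_fun_sum _ fun i _ => S.measurable_of_mem _ (hY.mem i)
  have hBn : S.cap (⋃ q, B q) = 0 := cap_iUnion_eq_zero hV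
    (fun q => measurableSet_frequently fun l => measurableSet_le measurable_const (hms _ X hX))
    fun q => cap_block_frequently hV hX hW (Nat.succ_pos q) _ (by positivity)
  have hCn : S.cap (⋃ q, C q) = 0 := cap_iUnion_eq_zero hV
    (fun q => measurableSet_frequently fun l => measurableSet_le measurable_const (hms _ Z hZT))
    fun q => cap_block_frequently hV hZT hZW one_pos _ one_pos
  refine le_antisymm ((cap_mono ?_).trans ((cap_union_le (⋃ q, B q) (⋃ q, C q)).trans
    (by rw [hBn, hCn, add_zero]))) bot_le
  intro ω hω
  by_contra hcon
  simp only [Set.mem_union, Set.mem_iUnion, not_or, not_exists] at hcon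
  obtain ⟨hcB, hcC⟩ := hcon
  have hev : ∀ᶠ l in atTop, ∀ q ∈ Finset.range (2 * M),
      (∑ i ∈ Finset.range ((q + 1) * 2 ^ l), X i ω < ((q + 1 : ℕ) * 2 ^ l : ℝ) * (μ + ε / 2)) ∧
      (∑ i ∈ Finset.Ico ((q + 1) * 2 ^ l) ((q + 1) * 2 ^ l + 2 ^ l), Z i ω
        < 2 ^ l * (ν + 1)) := by
    rw [eventually_all_finset]
    intro q _
    have h1 := not_frequently.1 (hcB q)
    have h2 := not_frequently.1 (hcC q)
    filter_upwards [h1, h2] with l hl1 hl2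
    constructor
    · rw [Finset.range_eq_Ico]
      simpa only [Set.mem_ofPred_eq, not_le, zero_add] using hl1
    · simpa only [Set.mem_ofPred_eq, not_le, one_mul, Nat.cast_one] using hl2
  obtain ⟨l₀, hl₀⟩ := eventually_atTop.1 hev
  obtain ⟨n, hn, hlt⟩ := frequently_atTop.1 hω (M * 2 ^ l₀)
  obtain ⟨l, q, hll, hqM, hl1', hq1, hq2⟩ := exists_dyadic_block hM0 hn
  obtain ⟨hA1, hA2⟩ := hl₀ l hll q (Finset.mem_range.2 hqM)
  have hsplit : ∑ i ∈ Finset.range n, X i ω ≤ ∑ i ∈ Finset.range ((q + 1) * 2 ^ l), X i ω +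
      ∑ i ∈ Finset.Ico ((q + 1) * 2 ^ l) ((q + 1) * 2 ^ l + 2 ^ l), Z i ω := by
    rw [← Finset.sum_range_add_sum_Ico _ hq1]
    refine add_le_add le_rfl ?_
    refine (Finset.sum_le_sum fun i _ => le_max_left (X i ω) 0).trans ?_
    exact Finset.sum_le_sum_of_subset_of_nonneg (Finset.Ico_subset_Ico le_rfl hq2.le)
      fun i _ _ => le_max_right _ _
  have hq1r : ((q + 1 : ℕ) : ℝ) * 2 ^ l ≤ n := by exact_mod_cast hq1
  have hq2r : (n : ℝ) ≤ (q + 1 : ℕ) * 2 ^ l + 2 ^ l := by exact_mod_cast hq2.le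
  have hl1r : (2 : ℝ) ^ l * M ≤ n := by exact_mod_cast hl1'
  have h1 : (2 : ℝ) ^ l * (|μ| + ν + 1) ≤ n * (ε / 2) := by
    rw [div_lt_iff₀ hε] at hM
    have : (2 : ℝ) ^ l * (2 * (|μ| + ν + 1)) ≤ 2 ^ l * (M * ε) :=
      mul_le_mul_of_nonneg_left hM.le (by positivity)
    nlinarith
  have h2 : ((q + 1 : ℕ) * 2 ^ l : ℝ) * μ ≤ n * μ + 2 ^ l * |μ| := by
    have hd : 0 ≤ (n : ℝ) - (q + 1 : ℕ) * 2 ^ l := by linarith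
    have := neg_abs_le μ
    have := abs_nonneg μ
    nlinarith
  nlinarith

/-- The upper half of the strong law of large numbers. -/
lemma cap_limsup_gt (hV : CountablySubadditive S.cap) (hX : S.Tame X)
    (hW : S.WeakNegDep X) :
    S.cap {ω | S.E (X 0) < limsup (fun n => (avg X n ω : EReal)) atTop} = 0 := by
  set A : ℕ → Set Ω := fun m => {ω | ∃ᶠ n : ℕ in atTop, n * (S.e (X 0) + 1 / ((m : ℝ) + 1)) <
    ∑ i ∈ Finset.range n, X i ω} with hA
  have hms : ∀ s : Finset ℕ, Measurable fun ω => ∑ i ∈ s, X i ω :=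
    fun s => Finset.measurable_fun_sum _ fun i _ => S.measurable_of_mem _ (hX.mem i)
  have h0 : S.cap (⋃ m, A m) = 0 := cap_iUnion_eq_zero hV
    (fun m => measurableSet_frequently fun l => measurableSet_lt measurable_const (hms _))
    fun m => cap_upper_frequently hV hX hW (by positivity)
  refine le_antisymm ((cap_mono ?_).trans h0.le) bot_le
  intro ω hω
  by_contra hcon
  simp only [Set.mem_iUnion, not_exists] at hcon
  rw [Set.mem_ofPred_eq] at hω
  refine (not_le.2 hω) ?_
  rw [← hX.coe_e]
  refine EReal.le_of_forall_lt_iff_le.1 fun z hz => ?_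
  rw [EReal.coe_lt_coe_iff] at hz
  obtain ⟨m, hm⟩ := exists_nat_one_div_lt (sub_pos.2 hz)
  refine limsup_le_of_le (by isBoundedDefault) ?_
  have := not_frequently.1 (hcon m)
  filter_upwards [this, eventually_gt_atTop 0] with n hn hn0
  rw [EReal.coe_le_coe_iff, avg, div_le_iff₀ (by exact_mod_cast hn0)]
  have hn0' : (0 : ℝ) < n := by exact_mod_cast hn0
  nlinarith [not_lt.1 hn]

/-- The strong law of large numbers for the two sides together. -/
lemma cap_liminf_lt_union_limsup_gt (hV : CountablySubadditive S.cap) (hX : S.Tame X)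
    (hW : S.WeakNegDep X) (hW' : S.WeakNegDep fun n ω => -X n ω) :
    S.cap ({ω | liminf (fun n => (avg X n ω : EReal)) atTop < S.lowerE (X 0)} ∪
        {ω | S.E (X 0) < limsup (fun n => (avg X n ω : EReal)) atTop}) = 0 := by
  have h1 := cap_limsup_gt hV hX hW
  have h2 := cap_limsup_gt hV hX.neg hW'
  have h3 : {ω | liminf (fun n => (avg X n ω : EReal)) atTop < S.lowerE (X 0)} =
      {ω | S.E (fun ω => -X 0 ω) <
        limsup (fun n => (avg (fun n ω => -X n ω) n ω : EReal)) atTop} := by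
    ext ω
    have : (fun n => (avg (fun n ω => -X n ω) n ω : EReal)) = -fun n => (avg X n ω : EReal) := by
      funext n
      simp [avg, neg_div]
    simp only [Set.mem_ofPred_eq]
    rw [this, EReal.limsup_neg, lowerE, EReal.lt_neg_comm]
  refine le_antisymm ((cap_union_le _ _).trans ?_) bot_le
  rw [h1, h3, h2, add_zero]

end SublinExpSpace

/-! ### Choquet integrals as series, and reduction of the two dependence hypotheses. -/

lemma tsum_mul_le_lintegral_of_antitone {G : ℝ → ℝ≥0∞} (hG : Antitone G) {s : ℕ → ℝ}
    (hs : Monotone s) (h0 : ∀ n, 0 ≤ s n) :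
    ∑' n, ENNReal.ofReal (s (n + 1) - s n) * G (s (n + 1)) ≤ ∫⁻ t in Set.Ioi (0 : ℝ), G t := by
  calc ∑' n, ENNReal.ofReal (s (n + 1) - s n) * G (s (n + 1))
      ≤ ∑' n, ∫⁻ t in Set.Ioc (s n) (s (n + 1)), G t := by
        refine ENNReal.tsum_le_tsum fun n => ?_
        rw [mul_comm, ← Real.volume_Ioc, ← setLIntegral_const]
        exact setLIntegral_mono' measurableSet_Ioc fun t ht => hG ht.2
    _ = ∫⁻ t in ⋃ n, Set.Ioc (s n) (s (n + 1)), G t :=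
        (lintegral_iUnion (fun _ => measurableSet_Ioc) hs.pairwise_disjoint_on_Ioc_succ _).symm
    _ ≤ _ := lintegral_mono_set (Set.iUnion_subset fun n t ht => (h0 n).trans_lt ht.1)

lemma lintegral_le_tsum_of_antitone {G : ℝ → ℝ≥0∞} (hG : Antitone G) {M : ℝ} (hM : 0 < M) :
    ∫⁻ t in Set.Ioi (0 : ℝ), G t ≤ ∑' n : ℕ, ENNReal.ofReal M * G (M * n) := by
  calc ∫⁻ t in Set.Ioi (0 : ℝ), G t
      ≤ ∫⁻ t in ⋃ n : ℕ, Set.Ioc (M * n) (M * (n + 1)), G t := by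
        refine lintegral_mono_set fun t (ht : 0 < t) => Set.mem_iUnion.2 ?_
        have hc : 0 < ⌈t / M⌉₊ := Nat.ceil_pos.2 (by positivity)
        have h1 := Nat.le_ceil (t / M)
        have h2 := Nat.ceil_lt_add_one (a := t / M) (by positivity)
        refine ⟨⌈t / M⌉₊ - 1, ?_, ?_⟩
        · rw [← lt_div_iff₀' hM, Nat.cast_sub hc]; push_cast; linarith
        · rw [← div_le_iff₀' hM, Nat.cast_sub hc]; push_cast; linarith
    _ ≤ ∑' n : ℕ, ∫⁻ t in Set.Ioc (M * n) (M * (n + 1)), G t := lintegral_iUnion_le _ _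
    _ ≤ _ := by
        refine ENNReal.tsum_le_tsum fun n => ?_
        have : ENNReal.ofReal M = volume (Set.Ioc (M * n) (M * (n + 1))) := by
          rw [Real.volume_Ioc]; ring_nf
        rw [mul_comm (ENNReal.ofReal M), this, ← setLIntegral_const]
        exact setLIntegral_mono' measurableSet_Ioc fun t ht => hG ht.1.le

namespace SublinExpSpace

variable {Ω : Type*} [MeasurableSpace Ω] {S : SublinExpSpace Ω} {X : ℕ → Ω → ℝ}

lemma IdentDistSeq.e_eq (hid : S.IdentDistSeq X) (hX : ∀ n, X n ∈ S.H) (n : ℕ) {g : ℝ → ℝ}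
    (hg : BLip g) : S.e (fun ω => g (X n ω)) = S.e (fun ω => g (X 0 ω)) := by
  have hb : ∀ n, S.Bdd fun ω => g (X n ω) := fun n => Bdd.blip hg (hX n)
  have hφ : BLip fun x : Fin 1 → ℝ => g (x 0) :=
    hg.comp_lip zero_le_one fun x y => by simpa using norm_le_pi_norm (x - y) 0
  have := hid n (fun x => g (x 0)) hφ.locLip
  simp only [rvec, ← (hb n).coe_e, ← (hb 0).coe_e] at this
  exact EReal.coe_injective (this (by simp) (by simp) (by simp) (by simp))

lemma cap_abs_ge_antitone (U : Ω → ℝ) : Antitone fun t : ℝ => S.cap {ω | t ≤ |U ω|} :=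
  fun _ _ h => cap_mono fun _ hω => h.trans hω

lemma choquet_abs_lt_top_iff (U : Ω → ℝ) : choquet S.cap (fun ω => |U ω|) < ⊤ ↔
    ∫⁻ t in Set.Ioi (0 : ℝ), S.cap {ω | t ≤ |U ω|} ≠ ⊤ := by
  have h : ∫⁻ t in Set.Iio (0 : ℝ), (1 - S.cap {ω | t ≤ |U ω|}) = 0 := by
    rw [setLIntegral_congr_fun (g := fun _ => 0) measurableSet_Iio]
    · simp
    · intro t ht
      have : {ω | t ≤ |U ω|} = Set.univ :=
        Set.eq_univ_of_forall fun ω => (le_of_lt ht).trans (abs_nonneg (U ω))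
      simp only [this, cap_univ, tsub_self]
  rw [choquet, h, EReal.coe_ennreal_zero, sub_zero, lt_top_iff_ne_top, Ne,
    EReal.coe_ennreal_eq_top_iff]

lemma e_bump_nonneg {U : Ω → ℝ} (hU : U ∈ S.H) {r : ℝ} (hr : 0 < r) :
    0 ≤ S.e (fun ω => bump r (U ω)) :=
  const_le_e (Bdd.blip (blip_bump hr) hU) fun _ => bump_nonneg _ _

/-- Since `bump (2 ^ j)` vanishes below `2 ^ j / 2`, its expectation is at most the capacity at that
level. The nodes `2 ^ j / 4` make that level the right endpoint of an interval of length `2 ^ j /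
4`, which explains the factor `4`. -/
lemma summable_e_bump {U : Ω → ℝ} (hU : U ∈ S.H)
    (h : ∫⁻ t in Set.Ioi (0 : ℝ), S.cap {ω | t ≤ |U ω|} ≠ ⊤) :
    Summable fun j : ℕ => 2 ^ j * S.e (fun ω => bump (2 ^ j) (U ω)) := by
  have h1 := tsum_mul_le_lintegral_of_antitone (cap_abs_ge_antitone (S := S) U)
    (s := fun j => 2 ^ j / 4) (fun i j hij => by dsimp only; gcongr; norm_num)
    (fun j => by positivity)
  have h2 : ∑' j : ℕ, ENNReal.ofReal (2 ^ j * S.e (fun ω => bump (2 ^ j) (U ω))) ≠ ⊤ := by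
    refine ne_top_of_le_ne_top (ENNReal.mul_ne_top (ENNReal.ofReal_ne_top (r := 4))
      (ne_top_of_le_ne_top h h1)) ?_
    rw [← ENNReal.tsum_mul_left]
    refine ENNReal.tsum_le_tsum fun j => ?_
    rw [ENNReal.ofReal_mul (by positivity), ← mul_assoc,
      ← ENNReal.ofReal_mul (p := 4) (by norm_num)]
    have he : (2 : ℝ) ^ j = 4 * (2 ^ (j + 1) / 4 - 2 ^ j / 4) := by ring
    rw [← he]
    refine mul_le_mul_right ?_ _
    refine le_cap (Bdd.blip (blip_bump (by positivity)) hU) (fun _ => bump_le_one _ _) ?_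
    intro ω hω
    refine (bump_eq_zero (by positivity) ?_).le
    rw [Set.mem_ofPred_eq, not_le, pow_succ] at hω
    linarith
  have h3 := ENNReal.summable_toReal h2
  refine h3.congr fun j => ENNReal.toReal_ofReal ?_
  exact mul_nonneg (by positivity) (e_bump_nonneg hU (by positivity))

lemma tame_of_choquet (hX : ∀ n, X n ∈ S.H) (hid : S.IdentDistSeq X)
    (hc : choquet S.cap (fun ω => |X 0 ω|) < ⊤)
    (hu : Tendsto (fun c : ℝ => S.E (fun ω => max (|X 0 ω| - c) 0)) atTop (𝓝 0)) : S.Tame X where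
  mem := hX
  ident n _ hg := hid.e_eq hX n hg
  tail := summable_e_bump (hX 0) ((choquet_abs_lt_top_iff _).1 hc)
  ui := hu

lemma NegDepSeq.e_mul_le (hD : S.NegDepSeq X) (hX : ∀ n, X n ∈ S.H) {n : ℕ}
    {F : (Fin n → ℝ) → ℝ} {h : ℝ → ℝ} (hF : BLip F) (hh : BLip h)
    (hm : (Monotone F ∧ Monotone h) ∨ (Antitone F ∧ Antitone h))
    (hF0 : ∀ x, 0 ≤ F x) (he : S.e (fun ω => h (X n ω)) = 0) :
    S.e (fun ω => F (fun k => X k ω) * h (X n ω)) ≤ 0 := by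
  have hhb : S.Bdd fun ω => h (X n ω) := Bdd.blip hh (hX n)
  rcases n with - | n
  -- The first variable has no predecessors and the hypothesis says nothing about it, but `F` is
  -- then a nonnegative constant.
  · have : (fun ω => F (fun k : Fin 0 => X k ω) * h (X 0 ω)) =
        fun ω => F (fun k => k.elim0) * h (X 0 ω) := by
      funext ω
      congr 2
      exact Subsingleton.elim _ _
    rw [this, e_smul (hF0 _) hhb, he, mul_zero]
  · have hFb : S.Bdd fun ω => F (fun k : Fin (n + 1) => X k ω) := Bdd.past (fun k => hX k) hF
    have hφ : BLip fun x : Fin 1 → ℝ => h (x 0) :=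
      hh.comp_lip zero_le_one fun x y => by simpa using norm_le_pi_norm (x - y) 0
    have he' : S.E (fun ω => h (X (n + 1) ω)) = 0 := by rw [← hhb.coe_e, he, EReal.coe_zero]
    have key : S.E (fun ω => F (fun k => X k ω) * h (X (n + 1) ω)) ≤
        S.E (fun ω => F (fun k => X k ω)) * S.E (fun ω => h (X (n + 1) ω)) := by
      refine hD n F (fun x => h (x 0)) hF.locLip hφ.locLip (fun ω => hF0 _) he'.ge
        (hFb.mul hhb).abs.lt_top hFb.abs.lt_top hhb.abs.lt_top ?_
      rcases hm with hm | hm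
      · exact Or.inl ⟨hm.1, fun x y hxy => hm.2 (hxy 0)⟩
      · exact Or.inr ⟨hm.1, fun x y hxy => hm.2 (hxy 0)⟩
    rw [he', mul_zero, ← (hFb.mul hhb).coe_e] at key
    exact_mod_cast key

lemma NegDepSeq.weakNegDep (hD : S.NegDepSeq X) (hX : ∀ n, X n ∈ S.H) : S.WeakNegDep X :=
  fun _ _ _ hF hh hFm hhm hF0 he => hD.e_mul_le hX hF hh (Or.inl ⟨hFm, hhm⟩) hF0 he

/-- Non-decreasing functions of `-X` are non-increasing functions of `X`, so the antitone half of
negative dependence applies. -/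
lemma NegDepSeq.weakNegDep_neg (hD : S.NegDepSeq X) (hX : ∀ n, X n ∈ S.H) :
    S.WeakNegDep fun n ω => -X n ω := by
  intro n F h hF hh hFm hhm hF0 he
  refine hD.e_mul_le hX (F := fun x => F fun k => -x k) (h := fun x => h (-x)) ?_ ?_
    (Or.inr ⟨fun x y hxy => hFm fun k => neg_le_neg (hxy k), fun x y hxy => hhm (neg_le_neg hxy)⟩)
    (fun x => hF0 _) he
  · refine hF.comp_lip (u := fun x : Fin n → ℝ => fun k => -x k) zero_le_one fun x y => ?_
    rw [one_mul, ← norm_neg (x - y)]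
    refine le_of_eq (congrArg _ ?_)
    funext k
    simp
    ring
  · refine hh.comp_lip zero_le_one fun x y => ?_
    rw [one_mul, ← norm_neg (x - y)]
    exact le_of_eq (congrArg _ (by ring))

/-- Under independence the present may be averaged out of a function affine in it. -/
lemma IndepSeq.e_affine (hI : S.IndepSeq X) (hX : ∀ n, X n ∈ S.H) {n : ℕ}
    {A B : (Fin n → ℝ) → ℝ} {h : ℝ → ℝ} (hA : BLip A) (hB : BLip B) (hh : BLip h)
    (hB0 : ∀ x, 0 ≤ B x) :
    S.e (fun ω => A (fun k => X k ω) + B (fun k => X k ω) * h (X n ω)) =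
      S.e (fun ω => A (fun k => X k ω) + B (fun k => X k ω) * S.e (fun ω' => h (X n ω'))) := by
  have hhb : S.Bdd fun ω => h (X n ω) := Bdd.blip hh (hX n)
  -- The sign of `b` is essential: positive homogeneity gives an equality only for nonnegative
  -- coefficients.
  have hx : ∀ a b, 0 ≤ b → S.e (fun ω => a + b * h (X n ω)) = a + b * S.e (fun ω => h (X n ω)) := by
    intro a b hb
    rw [← e_smul hb hhb, add_comm a, ← e_add_const (hhb.smul b)]
    simp only [add_comm a]
  rcases n with - | n
  · have hs : ∀ ω, (fun k : Fin 0 => X k ω) = fun k => k.elim0 := fun ω => Subsingleton.elim _ _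
    simp only [hs]
    rw [hx _ _ (hB0 _), e_const]
  · set φ : (Fin (n + 1) → ℝ) × (Fin 1 → ℝ) → ℝ := fun p => A p.1 + B p.1 * h (p.2 0) with hφ
    have hφb : BLip φ := by
      refine (hA.comp_lip zero_le_one fun x y => ?_).add
        ((hB.comp_lip zero_le_one fun x y => ?_).mul (hh.comp_lip zero_le_one fun x y => ?_))
      · simpa using norm_fst_le (x - y)
      · simpa using norm_fst_le (x - y)
      · rw [one_mul]
        exact (norm_le_pi_norm (x.2 - y.2) 0).trans (norm_snd_le (x - y))
    have hxb : ∀ x, S.Bdd fun ω => φ (x, fun _ => X (n + 1) ω) := fun x =>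
      (Bdd.const (A x)).add ((Bdd.const (B x)).mul hhb)
    have hpast : ∀ {C : (Fin (n + 1) → ℝ) → ℝ}, BLip C →
        S.Bdd fun ω => C (fun k : Fin (n + 1) => X k ω) := fun hC => Bdd.past (fun k => hX k) hC
    -- The inner expectation is again bounded Lipschitz in the past, which supplies the membership
    -- in `H` that `IndepTo` demands.
    have hlift : ∀ {ψ : (Fin (n + 1) → ℝ) × (Fin 1 → ℝ) → ℝ}, BLip ψ →
        (∀ x, S.Bdd fun ω => ψ (x, fun _ => X (n + 1) ω)) →
        BLip fun x => S.e fun ω => ψ (x, fun _ => X (n + 1) ω) := by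
      intro ψ hψ hψb
      obtain ⟨K, hK, h1⟩ := hψ.bdd
      obtain ⟨L, hL, h2⟩ := hψ.lip
      refine ⟨⟨K, hK, fun x => ?_⟩, ⟨L, hL, fun x y => ?_⟩⟩
      · simpa [e_const] using abs_e_sub_le (hψb x) (Bdd.const 0) (c := K) fun ω => by
          simpa using h1 (x, fun _ => X (n + 1) ω)
      · refine abs_e_sub_le (hψb x) (hψb y) fun ω => (h2 _ _).trans_eq ?_
        rw [Prod.mk_sub_mk, sub_self, Prod.norm_mk, norm_zero, max_eq_left (norm_nonneg _)]
    have h1 := hlift hφb hxb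
    have h2 := hlift hφb.abs fun x => (hxb x).abs
    have key := hI n φ hφb.locLip (fun x => (hxb x).abs.lt_top)
      (hpast h2).1 (hpast h2).lt_top (hpast h1).1
    have hd : ∀ ω, (S.E fun ω' => φ (rvec (fun k : Fin (n + 1) => X k) ω,
        rvec (fun _ : Fin 1 => X (n + 1)) ω')).toReal =
        A (fun k => X k ω) + B (fun k => X k ω) * S.e (fun ω' => h (X (n + 1) ω')) :=
      fun ω => hx (A fun k => X k ω) (B fun k => X k ω) (hB0 _)
    simp only [hd] at key
    exact congrArg EReal.toReal key

/-- Here the covariance is exactly zero, so `u` need not be monotone. This admits `-x` and the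
remainders `(|x| - N)⁺`. -/
lemma IndepSeq.weakNegDep_comp (hI : S.IndepSeq X) (hX : ∀ n, X n ∈ S.H) {u : ℝ → ℝ}
    (hl : ∀ x y, |u x - u y| ≤ |x - y|) : S.WeakNegDep (fun n ω => u (X n ω)) := by
  intro n F h hF hh hFm hhm hF0 he
  have := hI.e_affine hX (n := n) (A := fun _ => 0) (B := fun x => F fun k => u (x k))
    (h := fun x => h (u x)) (BLip.const 0) (by
      refine hF.comp_lip (u := fun x : Fin n → ℝ => fun k => u (x k)) zero_le_one fun x y => ?_
      rw [one_mul, pi_norm_le_iff_of_nonneg (norm_nonneg _)]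
      intro k
      exact (hl _ _).trans (by simpa using norm_le_pi_norm (x - y) k))
    (hh.comp_lip zero_le_one fun x y => by simpa using hl x y) (fun x => hF0 _)
  simp only [he, zero_add, mul_zero, e_const] at this
  exact this.le

end SublinExpSpace

/-! ### Second Borel–Cantelli lemma and necessity of the Choquet condition. -/

lemma BLip.prod {E ι : Type*} [NormedAddCommGroup E] (s : Finset ι) {f : ι → E → ℝ}
    (hf : ∀ i ∈ s, BLip (f i)) : BLip (fun x => ∏ i ∈ s, f i x) := by
  classical
  induction s using Finset.induction_on with
  | empty => simpa using BLip.const 1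
  | insert a s ha ih =>
    simp only [Finset.prod_insert ha]
    exact (hf a (by simp)).mul (ih fun i hi => hf i (by simp [hi]))

namespace SublinExpSpace

variable {Ω : Type*} [MeasurableSpace Ω] {S : SublinExpSpace Ω} {X : ℕ → Ω → ℝ}

/-- With the minus sign the last factor enters through `+ P * f n`, where `P ≥ 0` is the product of
the earlier factors, so it can be averaged by the upper expectation. Without the sign, lower
expectations would appear. -/
lemma IndepSeq.e_neg_prod (hI : S.IndepSeq X) (hX : ∀ n, X n ∈ S.H) {f : ℕ → ℝ → ℝ}
    (hf : ∀ i, BLip (f i)) (h1 : ∀ i x, f i x ≤ 1) (n : ℕ) :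
    S.e (fun ω => -∏ i ∈ Finset.range n, (1 - f i (X i ω))) =
      -∏ i ∈ Finset.range n, (1 - S.e (fun ω => f i (X i ω))) := by
  induction n with
  | zero => simp [e_const]
  | succ n ih =>
    have hP : BLip fun x : Fin n → ℝ => ∏ i : Fin n, (1 - f i (x i)) :=
      BLip.prod _ fun i _ => (BLip.const 1).sub
        ((hf i).comp_lip zero_le_one fun x y => by simpa using norm_le_pi_norm (x - y) i)
    have key := hI.e_affine hX hP.neg hP (hf n)
      fun x => Finset.prod_nonneg fun i _ => sub_nonneg.2 (h1 _ _)
    have hprod : ∀ ω, ∏ i : Fin n, (1 - f i (X i ω)) = ∏ i ∈ Finset.range n, (1 - f i (X i ω)) :=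
      fun ω => Fin.prod_univ_eq_prod_range (fun i => 1 - f i (X i ω)) n
    simp only [hprod] at key
    set q := S.e fun ω => f n (X n ω)
    have hq : q ≤ 1 := e_le_const (Bdd.blip (hf n) (hX n)) fun ω => h1 _ _
    have hb : S.Bdd fun ω => -∏ i ∈ Finset.range n, (1 - f i (X i ω)) := by
      have := Bdd.past (S := S) (X := fun k : Fin n => X k) (fun k => hX k) hP.neg
      simpa only [hprod] using this
    have e1 : (fun ω => -∏ i ∈ Finset.range (n + 1), (1 - f i (X i ω))) = fun ω =>
        -∏ i ∈ Finset.range n, (1 - f i (X i ω)) +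
          (∏ i ∈ Finset.range n, (1 - f i (X i ω))) * f n (X n ω) := by
      funext ω
      rw [Finset.prod_range_succ]; ring
    have e2 : (fun ω => -∏ i ∈ Finset.range n, (1 - f i (X i ω)) +
          (∏ i ∈ Finset.range n, (1 - f i (X i ω))) * q) = fun ω =>
        (1 - q) * -∏ i ∈ Finset.range n, (1 - f i (X i ω)) := by
      funext ω
      ring
    rw [e1, key, e2, e_smul (by linarith) hb, ih, Finset.prod_range_succ]
    ring

/-- The second Borel–Cantelli lemma. -/
lemma IndepSeq.cap_frequently_eq_one (hI : S.IndepSeq X) (hX : ∀ n, X n ∈ S.H)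
    (hV : ContinuousCapacity S.cap) {f : ℕ → ℝ → ℝ} (hf : ∀ i, BLip (f i))
    (h0 : ∀ i x, 0 ≤ f i x) (h1 : ∀ i x, f i x ≤ 1) {A : ℕ → Set Ω}
    (hA : ∀ n, MeasurableSet (A n)) (hfA : ∀ i ω, ω ∉ A i → f i (X i ω) = 0)
    (hs : ¬ Summable fun i => S.e (fun ω => f i (X i ω))) :
    S.cap {ω | ∃ᶠ n in atTop, ω ∈ A n} = 1 := by
  refine SublinExpSpace.cap_frequently_eq_one hV hA fun k => le_antisymm (cap_le_one _) ?_
  -- Suppressing the indices before `k` makes `1 - ∏ (1 - f' i)` a test function for the tail union;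
  -- its expectation tends to one because `∏ (1 - q i) ≤ exp (-∑ q i)`.
  set f' : ℕ → ℝ → ℝ := fun i x => if k ≤ i then f i x else 0 with hf'
  have hf'b : ∀ i, BLip (f' i) := fun i => by
    by_cases h : k ≤ i
    · simpa only [hf', h, if_true] using hf i
    · simpa only [hf', h, if_false] using BLip.const 0
  have hf'0 : ∀ i x, 0 ≤ f' i x := fun i x => by
    simp only [hf']; split_ifs
    exacts [h0 i x, le_rfl]
  have hf'1 : ∀ i x, f' i x ≤ 1 := fun i x => by
    simp only [hf']; split_ifs
    exacts [h1 i x, zero_le_one]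
  set q : ℕ → ℝ := fun i => S.e fun ω => f' i (X i ω)
  have hq0 : ∀ i, 0 ≤ q i := fun i =>
    const_le_e (Bdd.blip (hf'b i) (hX i)) fun ω => hf'0 _ _
  have hq1 : ∀ i, q i ≤ 1 := fun i => e_le_const (Bdd.blip (hf'b i) (hX i)) fun ω => hf'1 _ _
  have hqs : ¬ Summable q := by
    rw [← summable_nat_add_iff k]
    rw [← summable_nat_add_iff k] at hs
    simpa [q, hf'] using hs
  have hlim : Tendsto (fun n => ∏ i ∈ Finset.range n, (1 - q i)) atTop (𝓝 0) := by
    refine squeeze_zero (fun n => Finset.prod_nonneg fun i _ => sub_nonneg.2 (hq1 i)) (fun n => ?_)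
      (Real.tendsto_exp_neg_atTop_nhds_zero.comp
        ((not_summable_iff_tendsto_nat_atTop_of_nonneg hq0).1 hqs))
    rw [Function.comp, ← Finset.sum_neg_distrib, Real.exp_sum]
    exact Finset.prod_le_prod (fun i _ => sub_nonneg.2 (hq1 i)) fun i _ => by
      have := Real.add_one_le_exp (-q i)
      linarith
  have hlim' := (ENNReal.continuous_ofReal.tendsto _).comp (hlim.const_sub 1)
  rw [sub_zero, ENNReal.ofReal_one] at hlim'
  refine le_of_tendsto' hlim' fun n => ?_
  have hb : S.Bdd fun ω => -∏ i ∈ Finset.range n, (1 - f' i (X i ω)) := by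
    have hP : BLip fun x : Fin n → ℝ => ∏ i : Fin n, (1 - f' i (x i)) :=
      BLip.prod _ fun i _ => (BLip.const 1).sub
        ((hf'b i).comp_lip zero_le_one fun x y => by simpa using norm_le_pi_norm (x - y) i)
    have := Bdd.past (S := S) (X := fun k : Fin n => X k) (fun k => hX k) hP.neg
    have hprod : ∀ ω, ∏ i : Fin n, (1 - f' i (X i ω)) = ∏ i ∈ Finset.range n, (1 - f' i (X i ω)) :=
      fun ω => Fin.prod_univ_eq_prod_range (fun i => 1 - f' i (X i ω)) n
    simpa only [hprod] using this
  have h2 := le_cap (hb.add (Bdd.const 1)) (A := ⋃ n, A (n + k)) (fun ω => ?_) fun ω hω => ?_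
  · rwa [e_add_const hb, hI.e_neg_prod hX hf'b hf'1, neg_add_eq_sub] at h2
  · have : 0 ≤ ∏ i ∈ Finset.range n, (1 - f' i (X i ω)) :=
      Finset.prod_nonneg fun i _ => sub_nonneg.2 (hf'1 _ _)
    linarith
  · rw [Finset.prod_eq_one fun i _ => ?_]
    · norm_num
    · simp only [hf']
      split_ifs with h
      · rw [hfA i ω, sub_zero]
        intro hi
        exact hω (Set.mem_iUnion.2 ⟨i - k, by rwa [Nat.sub_add_cancel h]⟩)
      · simp

/-- If the Choquet integral is infinite, the averages are unbounded with capacity one. -/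
lemma IndepSeq.cap_limsup_abs_avg_eq_one (hI : S.IndepSeq X) (hX : ∀ n, X n ∈ S.H)
    (hid : S.IdentDistSeq X) (hV : ContinuousCapacity S.cap)
    (hc : ∫⁻ t in Set.Ioi (0 : ℝ), S.cap {ω | t ≤ |X 0 ω|} = ⊤) :
    S.cap {ω | limsup (fun n => ((|avg X n ω| : ℝ) : EReal)) atTop = ⊤} = 1 := by
  -- The threshold is halved because `bump r` is supported on `|x| ≥ r / 2`.
  set A : ℕ → ℕ → Set Ω := fun M n => {ω | ((M + 1 : ℕ) : ℝ) * (n + 1) / 2 ≤ |X n ω|} with hA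
  have hAm : ∀ M n, MeasurableSet (A M n) := fun M n =>
    measurableSet_le measurable_const (S.measurable_of_mem _ (abs_mem (hX n)))
  have h1 : ∀ M, S.cap {ω | ∃ᶠ n in atTop, ω ∈ A M n} = 1 := by
    intro M
    have hM : (0 : ℝ) < (M + 1 : ℕ) := by positivity
    have hr : ∀ i : ℕ, (0 : ℝ) < (M + 1 : ℕ) * (i + 1) := fun i => by positivity
    refine hI.cap_frequently_eq_one hX hV (f := fun i => bump ((M + 1 : ℕ) * (i + 1)))
      (fun i => blip_bump (hr i)) (fun i x => bump_nonneg _ _) (fun i x => bump_le_one _ _)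
      (hAm M) (fun i ω hω => bump_eq_zero (hr i) (not_le.1 hω).le) fun hs => ?_
    have hle := lintegral_le_tsum_of_antitone (cap_abs_ge_antitone (S := S) (X 0)) hM
    rw [hc, top_le_iff, ENNReal.tsum_mul_left, ENNReal.mul_eq_top] at hle
    have hfin : ∑' n : ℕ, S.cap {ω | ((M + 1 : ℕ) : ℝ) * n ≤ |X 0 ω|} ≠ ⊤ := by
      rw [tsum_eq_zero_add' ENNReal.summable]
      refine ENNReal.add_ne_top.2 ⟨cap_ne_top _, ne_top_of_le_ne_top hs.tsum_ofReal_ne_top ?_⟩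
      refine ENNReal.tsum_le_tsum fun i => ?_
      rw [hid.e_eq hX i (blip_bump (hr i))]
      refine cap_le (Bdd.blip (blip_bump (hr i)) (hX 0)) (fun ω => bump_nonneg _ _)
        fun ω hω => (bump_eq_one (hr i) ?_).ge
      rw [Set.mem_ofPred_eq] at hω
      exact_mod_cast hω
    rcases hle with h | h
    · exact hfin h.2
    · exact ENNReal.ofReal_ne_top h.1
  have h2 := hV.2 (fun M => {ω | ∃ᶠ n in atTop, ω ∈ A M n})
    (fun M => measurableSet_frequently (hAm M)) (by
      intro M N hMN ω hω
      refine Frequently.mono hω fun n hn => ?_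
      simp only [hA, Set.mem_ofPred_eq] at hn ⊢
      refine le_trans ?_ hn
      gcongr)
  simp only [h1] at h2
  have h3 := tendsto_nhds_unique h2 tendsto_const_nhds
  refine le_antisymm (cap_le_one _) (h3.ge.trans (cap_mono fun ω hω => ?_))
  rw [Set.mem_ofPred_eq]
  by_contra hne
  obtain ⟨c, hc1, -⟩ := EReal.lt_iff_exists_real_btwn.1 (lt_top_iff_ne_top.2 hne)
  obtain ⟨C, hC⟩ := exists_nat_ge c
  have hev : ∀ᶠ n : ℕ in atTop, |∑ i ∈ Finset.range n, X i ω| ≤ C * n := by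
    filter_upwards [eventually_lt_of_limsup_lt hc1, eventually_gt_atTop 0] with n hn hn0
    have hn0' : (0 : ℝ) < n := by exact_mod_cast hn0
    rw [EReal.coe_lt_coe_iff, avg, abs_div, Nat.abs_cast, div_lt_iff₀ hn0'] at hn
    nlinarith
  -- This index makes the threshold `(2 * C + 1) * (n + 1)`, above the bound `C * (n + 1) + C * n`
  -- for the difference of two consecutive sums.
  have hfr : ∃ᶠ n in atTop, ω ∈ A (4 * C + 1) n := Set.mem_iInter.1 hω (4 * C + 1)
  obtain ⟨n, hn, hn1, hn2⟩ :=
    (hfr.and_eventually (hev.and ((tendsto_add_atTop_nat 1).eventually hev))).exists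
  rw [Finset.sum_range_succ] at hn2
  have hn' : ((4 * C + 1 + 1 : ℕ) : ℝ) * (n + 1) / 2 ≤ |X n ω| := hn
  push_cast at hn' hn2
  have h5 := abs_le.1 hn1
  have h6 := abs_le.1 hn2
  have h7 : |X n ω| ≤ C * (n + 1) + C * n := abs_le.2 ⟨by linarith, by linarith⟩
  have hC0 : (0 : ℝ) ≤ C := Nat.cast_nonneg _
  have hn0 : (0 : ℝ) ≤ n := Nat.cast_nonneg _
  nlinarith

end SublinExpSpace

/-! ### Cluster points of a real sequence. -/

/-- A real sequence with vanishing increments clusters at every point between its lower and its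
upper limit. -/
lemma clusterSet_eq_Icc {x : ℕ → ℝ} {a b : ℝ}
    (ha : liminf (fun n => (x n : EReal)) atTop = a)
    (hb : limsup (fun n => (x n : EReal)) atTop = b)
    (hx : Tendsto (fun n => x (n + 1) - x n) atTop (𝓝 0)) : clusterSet x = Set.Icc a b := by
  ext c
  have hcl : c ∈ clusterSet x ↔ ∀ ε > 0, ∃ᶠ n in atTop, |x n - c| < ε := by
    refine (Metric.nhds_basis_ball.mapClusterPt_iff_frequently).trans ?_
    simp [Metric.mem_ball, Real.dist_eq]
  rw [hcl]
  constructor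
  · intro h
    constructor
    · by_contra! hlt
      have h1 : ∀ᶠ n in atTop, (((a + c) / 2 : ℝ) : EReal) < x n :=
        eventually_lt_of_lt_liminf (by rw [ha, EReal.coe_lt_coe_iff]; linarith)
      obtain ⟨n, hn, hn'⟩ := ((h ((a - c) / 2) (by linarith)).and_eventually h1).exists
      rw [EReal.coe_lt_coe_iff] at hn'
      linarith [(abs_lt.1 hn).2]
    · by_contra! hlt
      have h1 : ∀ᶠ n in atTop, (x n : EReal) < (((b + c) / 2 : ℝ) : EReal) :=
        eventually_lt_of_limsup_lt (by rw [hb, EReal.coe_lt_coe_iff]; linarith)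
      obtain ⟨n, hn, hn'⟩ := ((h ((c - b) / 2) (by linarith)).and_eventually h1).exists
      rw [EReal.coe_lt_coe_iff] at hn'
      linarith [(abs_lt.1 hn).1]
  · rintro ⟨hac, hcb⟩ ε hε
    by_contra hcon
    rw [not_frequently] at hcon
    have hinc : ∀ᶠ n in atTop, |x (n + 1) - x n| < ε := by
      simpa [Real.dist_eq] using hx.eventually (Metric.ball_mem_nhds 0 hε)
    obtain ⟨n₀, hn₀⟩ := eventually_atTop.1 (hcon.and hinc)
    have hfar : ∀ n ≥ n₀, x n ≤ c - ε ∨ c + ε ≤ x n := fun n hn => by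
      have := (hn₀ n hn).1
      rw [not_lt, le_abs] at this
      rcases this with h | h
      · exact Or.inr (by linarith)
      · exact Or.inl (by linarith)
    -- Steps shorter than `ε` cannot cross the forbidden gap of width `2 * ε`, so the sequence stays
    -- on one side of it, against the value of its upper or lower limit.
    rcases hfar n₀ le_rfl with h0 | h0
    · have hall : ∀ n ≥ n₀, x n ≤ c - ε := by
        intro n hn
        induction n, hn using Nat.le_induction with
        | base => exact h0
        | succ n hn ih =>
          rcases hfar (n + 1) (by omega) with h | h
          · exact h
          · linarith [(abs_lt.1 (hn₀ n hn).2).2]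
      have : limsup (fun n => (x n : EReal)) atTop ≤ ((c - ε : ℝ) : EReal) :=
        limsup_le_of_le (by isBoundedDefault)
          (eventually_atTop.2 ⟨n₀, fun n hn => EReal.coe_le_coe_iff.2 (hall n hn)⟩)
      rw [hb, EReal.coe_le_coe_iff] at this
      linarith
    · have hall : ∀ n ≥ n₀, c + ε ≤ x n := by
        intro n hn
        induction n, hn using Nat.le_induction with
        | base => exact h0
        | succ n hn ih =>
          rcases hfar (n + 1) (by omega) with h | h
          · linarith [(abs_lt.1 (hn₀ n hn).2).1]
          · exact h
      have : ((c + ε : ℝ) : EReal) ≤ liminf (fun n => (x n : EReal)) atTop :=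
        le_liminf_of_le (by isBoundedDefault)
          (eventually_atTop.2 ⟨n₀, fun n hn => EReal.coe_le_coe_iff.2 (hall n hn)⟩)
      rw [ha, EReal.coe_le_coe_iff] at this
      linarith

/-! ### Blocks with extreme averages under independence. -/

namespace SublinExpSpace

variable {Ω : Type*} [MeasurableSpace Ω] {S : SublinExpSpace Ω} {X : ℕ → Ω → ℝ}

/-- A second moment bound under the lower expectation for a block following the past on which
`φ` depends. -/
lemma IndepSeq.e_neg_sub_sq_ge (hI : S.IndepSeq X) (hX : S.Tame X) {g : ℝ → ℝ} (hg : BLip g)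
    (he : S.e (fun ω => g (X 0 ω)) = 0) {K : ℝ} (hK : ∀ x, g x ^ 2 ≤ K) {a : ℕ}
    {φ : (Fin a → ℝ) → ℝ} (hφ : BLip φ) (r : ℕ) :
    S.e (fun ω => φ (fun k => X k ω)) - r * K ≤
      S.e (fun ω => φ (fun k => X k ω) -
        max (∑ i ∈ Finset.range r, -g (X (a + i) ω)) 0 ^ 2) := by
  induction r with
  | zero => simp
  | succ r ih =>
    set T : (Fin (a + r) → ℝ) → ℝ := fun x => max (∑ i : Fin r, -g (x (Fin.natAdd a i))) 0 with hT
    have hTb : BLip T := (BLip.sum _ fun i _ => (hg.comp_lip zero_le_one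
      fun x y => by simpa using norm_le_pi_norm (x - y) (Fin.natAdd a i)).neg).max_zero
    have hφ' : BLip fun x : Fin (a + r) → ℝ => φ fun k => x (Fin.castAdd r k) := by
      refine hφ.comp_lip (u := fun x : Fin (a + r) → ℝ => fun k => x (Fin.castAdd r k))
        zero_le_one fun x y => ?_
      rw [one_mul, pi_norm_le_iff_of_nonneg (norm_nonneg _)]
      exact fun k => norm_le_pi_norm (x - y) (Fin.castAdd r k)
    -- Expanding `-max (s - g) 0 ^ 2` produces `g` with coefficient `2 * T ≥ 0`, so the cross term
    -- averages to `2 * T * E[g] = 0`, and each new variable costs only `K`.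
    have key := hI.e_affine hX.mem (hφ'.sub hTb.sq) ((BLip.const 2).mul hTb) hg
      fun x => mul_nonneg zero_le_two (le_max_right _ _)
    rw [hX.ident _ g hg, he] at key
    have hTX : ∀ ω, T (fun k => X k ω) = max (∑ i ∈ Finset.range r, -g (X (a + i) ω)) 0 := by
      intro ω
      rw [← Fin.sum_univ_eq_sum_range (fun i => -g (X (a + i) ω)) r]
      rfl
    simp only [hTX, Fin.val_castAdd, mul_zero, add_zero] at key
    have hgb : ∀ i, S.Bdd fun ω => g (X i ω) := fun i => Bdd.blip hg (hX.mem i)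
    have hφb : S.Bdd fun ω => φ (fun k => X k ω) := Bdd.past (fun k => hX.mem k) hφ
    have hs : ∀ r, S.Bdd fun ω => max (∑ i ∈ Finset.range r, -g (X (a + i) ω)) 0 := fun r =>
      (Bdd.sum _ fun i _ => (hgb _).neg).max_zero
    have hb := (hφb.sub (hs r).sq).add (((Bdd.const 2).mul (hs r)).mul (hgb (a + r)))
    have h1 := e_mono (hb.add (Bdd.const (-K))) (hφb.sub (hs (r + 1)).sq) fun ω => by
      rw [Finset.sum_range_succ]
      have h2 := sq_max_add_le (∑ i ∈ Finset.range r, -g (X (a + i) ω)) (-g (X (a + r) ω))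
      have h3 := hK (X (a + r) ω)
      rw [neg_sq] at h2
      linarith
    rw [e_add_const hb, key] at h1
    push_cast
    linarith

/-- Two consecutive blocks of a bounded function of the sequence, the first with a large and the
second with a small average. -/
lemma IndepSeq.cap_two_blocks_ge (hI : S.IndepSeq X) (hX : S.Tame X) {g h : ℝ → ℝ} (hg : BLip g)
    (hh : BLip h) (hge : S.e (fun ω => g (X 0 ω)) = 0) (hhe : S.e (fun ω => h (X 0 ω)) = 0)
    {K : ℝ} (hgK : ∀ x, g x ^ 2 ≤ K) (hhK : ∀ x, h x ^ 2 ≤ K) {η : ℝ} (hη : 0 < η) {p r : ℕ}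
    (hp : 0 < p) (hr : 0 < r) :
    ENNReal.ofReal (1 - K / η ^ 2 / p - K / η ^ 2 / r) ≤
      S.cap {ω | -(p * η) < ∑ i ∈ Finset.range p, g (X i ω) ∧
        -(r * η) < ∑ i ∈ Finset.range r, h (X (p + i) ω)} := by
  have hp' : (0 : ℝ) < p := by exact_mod_cast hp
  have hr' : (0 : ℝ) < r := by exact_mod_cast hr
  have hscale : ∀ {f : ℝ → ℝ}, BLip f → S.e (fun ω => f (X 0 ω)) = 0 → (∀ x, f x ^ 2 ≤ K) →
      ∀ c : ℝ, 0 ≤ c → BLip (fun x => c * f x) ∧ S.e (fun ω => c * f (X 0 ω)) = 0 ∧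
        ∀ x, (c * f x) ^ 2 ≤ c ^ 2 * K := by
    intro f hf hfe hfK c hc
    refine ⟨(BLip.const c).mul hf, ?_, fun x => ?_⟩
    · rw [e_smul hc (Bdd.blip hf (hX.mem 0)), hfe, mul_zero]
    · rw [mul_pow]
      exact mul_le_mul_of_nonneg_left (hfK x) (sq_nonneg c)
  -- With this scaling, failure of a block condition makes its squared positive part at least one,
  -- so the test variable is nonpositive off the event.
  obtain ⟨g1, g2, g3⟩ := hscale hg hge hgK (p * η)⁻¹ (by positivity)
  obtain ⟨h1, h2, h3⟩ := hscale hh hhe hhK (r * η)⁻¹ (by positivity)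
  set c : ℝ := (p * η)⁻¹ with hc
  set d : ℝ := (r * η)⁻¹ with hd
  have hc0 : 0 < c := by positivity
  have hd0 : 0 < d := by positivity
  have k1 := hI.e_neg_sub_sq_ge hX g1 g2 g3 (a := 0) (BLip.const 0) p
  have hφ : BLip fun x : Fin p → ℝ => -max (∑ i : Fin p, -(c * g (x i))) 0 ^ 2 :=
    (BLip.sum _ fun i _ => (g1.comp_lip zero_le_one
      fun x y => by simpa using norm_le_pi_norm (x - y) i).neg).max_zero.sq.neg
  -- The first block's penalty is carried along as the function `φ` of the past, so both blocks are
  -- controlled under one expectation.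
  have k2 := hI.e_neg_sub_sq_ge hX h1 h2 h3 hφ r
  have hsum : ∀ ω, ∑ i : Fin p, -(c * g (X i ω)) = ∑ i ∈ Finset.range p, -(c * g (X i ω)) :=
    fun ω => Fin.sum_univ_eq_sum_range (fun i => -(c * g (X i ω))) p
  simp only [zero_add, zero_sub, e_const] at k1
  simp only [hsum] at k2
  have hb : S.Bdd fun ω => -max (∑ i ∈ Finset.range p, -(c * g (X i ω))) 0 ^ 2 -
      max (∑ i ∈ Finset.range r, -(d * h (X (p + i) ω))) 0 ^ 2 :=
    ((Bdd.sum _ fun i _ => (Bdd.blip g1 (hX.mem i)).neg).max_zero.sq.neg).sub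
      (Bdd.sum _ fun i _ => (Bdd.blip h1 (hX.mem (p + i))).neg).max_zero.sq
  refine le_trans (ENNReal.ofReal_le_ofReal ?_) (le_cap (hb.add (Bdd.const 1)) (fun ω => ?_) ?_)
  · rw [e_add_const hb]
    have e1 : K / η ^ 2 / p = p * (c ^ 2 * K) := by rw [hc]; field_simp
    have e2 : K / η ^ 2 / r = r * (d ^ 2 * K) := by rw [hd]; field_simp
    rw [e1, e2]
    linarith
  · have := sq_nonneg (max (∑ i ∈ Finset.range p, -(c * g (X i ω))) 0)
    have := sq_nonneg (max (∑ i ∈ Finset.range r, -(d * h (X (p + i) ω))) 0)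
    linarith
  · intro ω hω
    have hone : ∀ {t : ℝ}, 1 ≤ t → 1 ≤ max t 0 ^ 2 := fun ht =>
      one_le_pow₀ (le_max_of_le_left ht)
    have := sq_nonneg (max (∑ i ∈ Finset.range p, -(c * g (X i ω))) 0)
    have := sq_nonneg (max (∑ i ∈ Finset.range r, -(d * h (X (p + i) ω))) 0)
    rw [Set.mem_ofPred_eq, not_and_or, not_lt, not_lt] at hω
    rcases hω with hω | hω
    · have : 1 ≤ ∑ i ∈ Finset.range p, -(c * g (X i ω)) := by
        rw [Finset.sum_neg_distrib, ← Finset.mul_sum, ← mul_neg, hc, inv_mul_eq_div,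
          le_div_iff₀ (by positivity)]
        linarith
      have := hone this
      linarith
    · have : 1 ≤ ∑ i ∈ Finset.range r, -(d * h (X (p + i) ω)) := by
        rw [Finset.sum_neg_distrib, ← Finset.mul_sum, ← mul_neg, hd, inv_mul_eq_div,
          le_div_iff₀ (by positivity)]
        linarith
      have := hone this
      linarith

/-- The length `k ^ 2` makes the first block negligible in the sum up to `k + k ^ 2`. Both Chebyshev
errors vanish as `k → ∞`, so every tail union has capacity one. -/
lemma IndepSeq.cap_two_blocks_frequently (hI : S.IndepSeq X) (hX : S.Tame X)
    (hV : ContinuousCapacity S.cap) {N : ℝ} (hN : 0 ≤ N) {η : ℝ} (hη : 0 < η) :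
    S.cap {ω | ∃ᶠ k : ℕ in atTop,
      k * (S.e (fun ω => clamp N (X 0 ω)) - η) < ∑ i ∈ Finset.range k, clamp N (X i ω) ∧
      ∑ i ∈ Finset.range (k ^ 2), clamp N (X (k + i) ω) <
        k ^ 2 * (-S.e (fun ω => -clamp N (X 0 ω)) + η)} = 1 := by
  have hb : S.Bdd fun ω => clamp N (X 0 ω) := Bdd.blip (blip_clamp N) (hX.mem 0)
  set m := S.e fun ω => clamp N (X 0 ω) with hm
  set l := S.e fun ω => -clamp N (X 0 ω) with hl
  have hmN : |m| ≤ N := abs_le.2 ⟨const_le_e hb fun ω => (abs_le.1 (abs_clamp_le hN _)).1,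
    e_le_const hb fun ω => (abs_le.1 (abs_clamp_le hN _)).2⟩
  have hlN : |l| ≤ N := by
    have h := fun ω => abs_le.1 (abs_clamp_le hN (X 0 ω))
    exact abs_le.2 ⟨const_le_e hb.neg fun ω => by linarith [(h ω).2],
      e_le_const hb.neg fun ω => by linarith [(h ω).1]⟩
  have hsq : ∀ {y z : ℝ}, |y| ≤ N → |z| ≤ N → (y + z) ^ 2 ≤ (2 * N) ^ 2 := fun hy hz =>
    sq_le_sq' (by linarith [(abs_le.1 hy).1, (abs_le.1 hz).1])
      (by linarith [(abs_le.1 hy).2, (abs_le.1 hz).2])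
  have hge : S.e (fun ω => clamp N (X 0 ω) + -m) = 0 := by
    rw [e_add_const hb, ← hm]; ring
  have hhe : S.e (fun ω => -clamp N (X 0 ω) + -l) = 0 := by
    rw [e_add_const hb.neg, ← hl]; ring
  set A : ℕ → Set Ω := fun k => {ω | k * (m - η) < ∑ i ∈ Finset.range k, clamp N (X i ω)} ∩
      {ω | ∑ i ∈ Finset.range (k ^ 2), clamp N (X (k + i) ω) < k ^ 2 * (-l + η)} with hA
  have hms : ∀ (s : Finset ℕ) (j : ℕ), Measurable fun ω => ∑ i ∈ s, clamp N (X (j + i) ω) :=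
    fun s j => Finset.measurable_fun_sum _ fun i _ =>
      S.measurable_of_mem _ (Bdd.blip (blip_clamp N) (hX.mem (j + i))).1
  have hAm : ∀ k, MeasurableSet (A k) := fun k =>
    (measurableSet_lt measurable_const (by simpa using hms (Finset.range k) 0)).inter
      (measurableSet_lt (hms _ _) measurable_const)
  refine SublinExpSpace.cap_frequently_eq_one (A := A) hV hAm fun k =>
    le_antisymm (cap_le_one _) ?_
  set K := (2 * N) ^ 2
  have hlim : Tendsto (fun n : ℕ => ENNReal.ofReal (1 - K / η ^ 2 / n - K / η ^ 2 / (n ^ 2 : ℕ)))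
      atTop (𝓝 1) := by
    have h1 := tendsto_const_div_atTop_nhds_zero_nat (K / η ^ 2)
    have h2 := h1.comp (tendsto_pow_atTop (α := ℕ) two_ne_zero)
    have h3 := (ENNReal.continuous_ofReal.tendsto _).comp ((h1.const_sub 1).sub h2)
    simpa [Function.comp_def] using h3
  refine le_of_tendsto hlim ?_
  filter_upwards [eventually_gt_atTop 0, eventually_ge_atTop k] with n hn hnk
  refine (hI.cap_two_blocks_ge hX ((blip_clamp N).add (BLip.const (-m)))
    ((blip_clamp N).neg.add (BLip.const (-l))) hge hhe
    (fun x => hsq (abs_clamp_le hN x) (by rwa [abs_neg]))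
    (fun x => hsq (by rw [abs_neg]; exact abs_clamp_le hN x) (by rwa [abs_neg])) hη hn
    (pow_pos hn 2)).trans (cap_mono fun ω hω => Set.mem_iUnion.2 ⟨n - k, ?_⟩)
  rw [Nat.sub_add_cancel hnk]
  obtain ⟨hω1, hω2⟩ := hω
  simp only [Finset.sum_add_distrib, Finset.sum_neg_distrib, Finset.sum_const, Finset.card_range,
    nsmul_eq_mul] at hω1 hω2
  push_cast at hω2
  simp only [hA, Set.mem_inter_iff, Set.mem_ofPred_eq]
  constructor <;> linarith

end SublinExpSpace

/-! ### Removal of the truncation, and the limit statements. -/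

namespace SublinExpSpace

variable {Ω : Type*} [MeasurableSpace Ω] {S : SublinExpSpace Ω} {X : ℕ → Ω → ℝ}

/-- The upper law applies to the remainders themselves: mean at most `ε`, plus margin `ε`. -/
lemma IndepSeq.exists_remainder_small (hI : S.IndepSeq X) (hX : S.Tame X)
    (hV : CountablySubadditive S.cap) {ε : ℝ} (hε : 0 < ε) :
    ∃ N : ℝ, 0 ≤ N ∧ S.e (fun ω => max (|X 0 ω| - N) 0) ≤ ε ∧
      S.cap {ω | ∃ᶠ n : ℕ in atTop,
        n * (2 * ε) < ∑ i ∈ Finset.range n, max (|X i ω| - N) 0} = 0 := by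
  obtain ⟨N, hN, hN0⟩ := ((hX.e_rem_tendsto.eventually (gt_mem_nhds hε)).and
    (eventually_ge_atTop 0)).exists
  have hl : ∀ x y : ℝ, |max (|x| - N) 0 - max (|y| - N) 0| ≤ |x - y| := fun x y => by
    refine (abs_max_sub_max_le_abs _ _ _).trans ?_
    simpa using abs_abs_sub_abs_le_abs_sub x y
  have hZ : S.Tame fun n ω => max (|X n ω| - N) 0 :=
    hX.comp (u := fun x => max (|x| - N) 0) hl fun x => by
      rw [abs_of_nonneg (le_max_right _ _)]
      exact max_le (by linarith) (abs_nonneg _)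
  have hW := hI.weakNegDep_comp hX.mem hl
  refine ⟨N, hN0, hN.le, le_antisymm ?_ bot_le⟩
  refine (cap_mono fun ω hω => ?_).trans (cap_upper_frequently hV hZ hW hε).le
  refine Frequently.mono hω fun n hn => lt_of_le_of_lt ?_ hn
  refine mul_le_mul_of_nonneg_left ?_ (Nat.cast_nonneg n)
  linarith

/-- The budget `5 * ε` is: `ε` for the block average, `ε` for the truncated mean, `2 * ε` for the
remainders and, on the lower side, `ε` for the first block, which is bounded trivially by `k * N`.
-/
lemma IndepSeq.cap_near_extremes (hI : S.IndepSeq X) (hX : S.Tame X)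
    (hV : ContinuousCapacity S.cap) {ε : ℝ} (hε : 0 < ε) :
    S.cap ({ω | ∃ᶠ n : ℕ in atTop, n * (S.e (X 0) - 5 * ε) ≤ ∑ i ∈ Finset.range n, X i ω} ∩
      {ω | ∃ᶠ n : ℕ in atTop, ∑ i ∈ Finset.range n, X i ω ≤
        n * (-S.e (fun ω => -X 0 ω) + 5 * ε)}) = 1 := by
  obtain ⟨N, hN0, hNε, hnull⟩ :=
    hI.exists_remainder_small hX (countablySubadditive_of_continuous hV) hε
  refine cap_eq_one_of_diff_null (hI.cap_two_blocks_frequently hX hV hN0 hε) hnull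
    fun ω hω hωn => ?_
  have hm := abs_le.1 ((hX.abs_e_clamp_sub_le hN0).trans hNε)
  have hl : |S.e (fun ω => -clamp N (X 0 ω)) - S.e (fun ω => -X 0 ω)| ≤ ε := by
    have := hX.neg.abs_e_clamp_sub_le hN0
    simp only [clamp_neg hN0, abs_neg] at this
    exact this.trans hNε
  have hl := abs_le.1 hl
  set m := S.e fun ω => clamp N (X 0 ω)
  set l := S.e fun ω => -clamp N (X 0 ω)
  have hrem : ∀ᶠ n : ℕ in atTop,
      |∑ i ∈ Finset.range n, X i ω - ∑ i ∈ Finset.range n, clamp N (X i ω)| ≤ n * (2 * ε) := by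
    filter_upwards [not_frequently.1 hωn] with n hn
    rw [← Finset.sum_sub_distrib]
    refine (Finset.abs_sum_le_sum_abs _ _).trans ?_
    simp only [abs_sub_clamp hN0]
    exact not_lt.1 hn
  have hω' : ∃ᶠ k : ℕ in atTop, k * (m - ε) < ∑ i ∈ Finset.range k, clamp N (X i ω) ∧
      ∑ i ∈ Finset.range (k ^ 2), clamp N (X (k + i) ω) < k ^ 2 * (-l + ε) := hω
  constructor
  · refine (hω'.and_eventually hrem).mono fun n ⟨⟨h1, _⟩, h2⟩ => ?_
    have h3 := (abs_le.1 h2).1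
    have : (n : ℝ) * (S.e (X 0) - 5 * ε) ≤ n * (m - ε) - n * (2 * ε) := by
      rw [← mul_sub]
      exact mul_le_mul_of_nonneg_left (by linarith) (Nat.cast_nonneg n)
    linarith
  · have ht : Tendsto (fun k : ℕ => k + k ^ 2) atTop atTop :=
      tendsto_atTop_mono (fun k => Nat.le_add_right k _) tendsto_id
    refine ht.frequently ?_
    refine (hω'.and_eventually ((ht.eventually hrem).and
      (tendsto_natCast_atTop_atTop.eventually_ge_atTop ((N + |-l + ε|) / ε)))).mono
      fun k ⟨⟨_, h1⟩, h2, h3⟩ => ?_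
    have h4 := (abs_le.1 h2).2
    rw [Finset.sum_range_add (fun i => clamp N (X i ω))] at h4
    have h5 : ∑ i ∈ Finset.range k, clamp N (X i ω) ≤ k * N := by
      simpa using Finset.sum_le_card_nsmul (Finset.range k) _ N
        fun i _ => (abs_le.1 (abs_clamp_le hN0 (X i ω))).2
    rw [div_le_iff₀ hε] at h3
    have hk : (0 : ℝ) ≤ k := Nat.cast_nonneg k
    have h6 : (k : ℝ) * (N + |-l + ε|) ≤ k * (k * ε) := mul_le_mul_of_nonneg_left h3 hk
    have h7 : (k : ℝ) * -(-l + ε) ≤ k * |-l + ε| :=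
      mul_le_mul_of_nonneg_left (neg_le_abs _) hk
    have h8 : ((k + k ^ 2 : ℕ) : ℝ) * (-l + 4 * ε) ≤
        (k + k ^ 2 : ℕ) * (-S.e (fun ω => -X 0 ω) + 5 * ε) :=
      mul_le_mul_of_nonneg_left (by linarith) (Nat.cast_nonneg _)
    have h9 : 0 ≤ (k : ℝ) * ε := by positivity
    push_cast at h4 h8 ⊢
    nlinarith

/-- Under independence the averages attain both extreme means in the limit, with capacity one. -/
lemma IndepSeq.cap_extremes_eq_one (hI : S.IndepSeq X) (hX : S.Tame X)
    (hV : ContinuousCapacity S.cap) :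
    S.cap {ω | liminf (fun n => (avg X n ω : EReal)) atTop = S.lowerE (X 0) ∧
        limsup (fun n => (avg X n ω : EReal)) atTop = S.E (X 0)} = 1 := by
  have hnull := cap_liminf_lt_union_limsup_gt (countablySubadditive_of_continuous hV) hX
    (hI.weakNegDep_comp hX.mem (u := fun x => x) fun x y => le_rfl)
    (hI.weakNegDep_comp hX.mem (u := fun x => -x) fun x y => by
      rw [← abs_neg (x - y)]; exact le_of_eq (congrArg _ (by ring)))
  set D₁ : ℕ → Set Ω := fun m => {ω | ∃ᶠ n : ℕ in atTop,
    n * (S.e (X 0) - 1 / ((m : ℝ) + 1)) ≤ ∑ i ∈ Finset.range n, X i ω}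
  set D₂ : ℕ → Set Ω := fun m => {ω | ∃ᶠ n : ℕ in atTop,
    ∑ i ∈ Finset.range n, X i ω ≤ n * (-S.e (fun ω => -X 0 ω) + 1 / ((m : ℝ) + 1))}
  have hms : ∀ s : Finset ℕ, Measurable fun ω => ∑ i ∈ s, X i ω :=
    fun s => Finset.measurable_fun_sum _ fun i _ => S.measurable_of_mem _ (hX.mem i)
  have h1 : ∀ m, S.cap (D₁ m ∩ D₂ m) = 1 := by
    intro m
    have := hI.cap_near_extremes hX hV (ε := 1 / ((m : ℝ) + 1) / 5) (by positivity)
    rwa [mul_div_cancel₀ _ (by norm_num : (5 : ℝ) ≠ 0)] at this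
  have h2 := hV.2 (fun m => D₁ m ∩ D₂ m)
    (fun m => (measurableSet_frequently fun n => measurableSet_le measurable_const (hms _)).inter
      (measurableSet_frequently fun n => measurableSet_le (hms _) measurable_const)) (by
      intro m k hmk ω hω
      refine ⟨hω.1.mono fun n hn => le_trans ?_ hn, hω.2.mono fun n hn => hn.trans ?_⟩ <;>
      · have := one_div_le_one_div_of_le (by positivity : (0 : ℝ) < m + 1)
          (by exact_mod_cast Nat.succ_le_succ hmk : (m : ℝ) + 1 ≤ k + 1)
        exact mul_le_mul_of_nonneg_left (by linarith) (Nat.cast_nonneg n))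
  simp only [h1] at h2
  -- The block events give only that the extremes are reached; the opposite inequalities come from
  -- the null set of the two-sided law.
  refine cap_eq_one_of_diff_null (tendsto_nhds_unique h2 tendsto_const_nhds) hnull
    fun ω hω hωn => ?_
  rw [Set.mem_union, not_or, Set.mem_ofPred_eq, Set.mem_ofPred_eq] at hωn
  have hlow := not_lt.1 hωn.1
  have hup := not_lt.1 hωn.2
  have hle : S.lowerE (X 0) = ((-S.e (fun ω => -X 0 ω) : ℝ) : EReal) := by
    rw [lowerE, ← hX.neg.coe_e, EReal.coe_neg]
  refine ⟨le_antisymm ?_ hlow, le_antisymm hup ?_⟩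
  · rw [hle]
    refine EReal.le_of_forall_lt_iff_le.1 fun z hz => ?_
    rw [EReal.coe_lt_coe_iff] at hz
    obtain ⟨m, hm⟩ := exists_nat_one_div_lt (sub_pos.2 hz)
    refine liminf_le_of_frequently_le ?_ (by isBoundedDefault)
    have hf := ((Set.mem_iInter.1 hω m).2 : ω ∈ D₂ m)
    refine (hf.and_eventually (eventually_gt_atTop 0)).mono fun n ⟨hn, hn0⟩ => ?_
    have hn0' : (0 : ℝ) < n := by exact_mod_cast hn0
    rw [EReal.coe_le_coe_iff, avg, div_le_iff₀ hn0']
    nlinarith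
  · rw [← hX.coe_e]
    refine EReal.ge_of_forall_gt_iff_ge.1 fun z hz => ?_
    rw [EReal.coe_lt_coe_iff] at hz
    obtain ⟨m, hm⟩ := exists_nat_one_div_lt (sub_pos.2 hz)
    refine le_limsup_of_frequently_le ?_ (by isBoundedDefault)
    have hf := ((Set.mem_iInter.1 hω m).1 : ω ∈ D₁ m)
    refine (hf.and_eventually (eventually_gt_atTop 0)).mono fun n ⟨hn, hn0⟩ => ?_
    have hn0' : (0 : ℝ) < n := by exact_mod_cast hn0
    rw [EReal.coe_le_coe_iff, avg, le_div_iff₀ hn0']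
    nlinarith

/-- Under independence the increments of the averages vanish quasi-surely. -/
lemma IndepSeq.exists_null_tendsto_div (hI : S.IndepSeq X) (hX : S.Tame X)
    (hV : CountablySubadditive S.cap) :
    ∃ A : Set Ω, S.cap A = 0 ∧
      ∀ ω, ω ∉ A → Tendsto (fun n : ℕ => X n ω / ((n : ℝ) + 1)) atTop (𝓝 0) := by
  choose N hN0 hNε hnull using fun m : ℕ =>
    hI.exists_remainder_small hX hV (ε := 1 / ((m : ℝ) + 1)) (by positivity)
  refine ⟨_, cap_iUnion_eq_zero hV (fun m => measurableSet_frequently fun n =>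
    measurableSet_lt measurable_const (Finset.measurable_fun_sum _ fun i _ =>
      S.measurable_of_mem _ (max_sub_mem (hX.mem i) (N m)))) hnull, fun ω hω => ?_⟩
  rw [Metric.tendsto_atTop']
  intro δ hδ
  -- A single remainder is bounded by the sum of the first `n + 1`, hence by two thirds of `δ * (n +
  -- 1)`; the last third absorbs the truncation level `N m`.
  obtain ⟨m, hm⟩ := exists_nat_one_div_lt (by positivity : 0 < δ / 3)
  have hev := not_frequently.1 fun h => hω (Set.mem_iUnion.2 ⟨m, h⟩)
  have hbig := tendsto_natCast_atTop_atTop.eventually_ge_atTop (N m / (δ / 3))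
  obtain ⟨n₀, hn₀⟩ := eventually_atTop.1
    (((tendsto_add_atTop_nat 1).eventually hev).and hbig)
  refine ⟨n₀, fun n hn => ?_⟩
  obtain ⟨h1, h2⟩ := hn₀ n hn.le
  have hn1 : (0 : ℝ) < (n : ℝ) + 1 := by positivity
  rw [Real.dist_eq, sub_zero, abs_div, abs_of_pos hn1, div_lt_iff₀ hn1]
  have h3 := (Finset.single_le_sum (f := fun i => max (|X i ω| - N m) 0)
    (fun i _ => le_max_right _ _) (Finset.self_mem_range_succ n)).trans (not_lt.1 h1)
  have h4 := (le_max_left _ _).trans h3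
  rw [div_le_iff₀ (by positivity)] at h2
  push_cast at h4
  nlinarith

/-- Under independence the averages cluster exactly at the points between the extreme means,
with capacity one. -/
lemma IndepSeq.cap_clusterSet_eq_one (hI : S.IndepSeq X) (hX : S.Tame X)
    (hV : ContinuousCapacity S.cap) :
    S.cap {ω | clusterSet (fun n => avg X n ω) =
        {a : ℝ | S.lowerE (X 0) ≤ (a : EReal) ∧ (a : EReal) ≤ S.E (X 0)}} = 1 := by
  obtain ⟨A, hA, hdiv⟩ := hI.exists_null_tendsto_div hX (countablySubadditive_of_continuous hV)
  refine cap_eq_one_of_diff_null (hI.cap_extremes_eq_one hX hV) hA fun ω ⟨hinf, hsup⟩ hωA => ?_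
  have hle : S.lowerE (X 0) = ((-S.e (fun ω => -X 0 ω) : ℝ) : EReal) := by
    rw [lowerE, ← hX.neg.coe_e, EReal.coe_neg]
  rw [hle] at hinf
  rw [← hX.coe_e] at hsup
  rw [Set.mem_ofPred_eq, hle, ← hX.coe_e]
  simp only [EReal.coe_le_coe_iff]
  refine clusterSet_eq_Icc hinf hsup ?_
  obtain ⟨C, hC⟩ : ∃ C : ℝ, ∀ᶠ n in atTop, |avg X n ω| ≤ C := by
    refine ⟨max (S.e (X 0) + 1) (-(-S.e (fun ω => -X 0 ω) - 1)), ?_⟩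
    filter_upwards [eventually_lt_of_limsup_lt (b := ((S.e (X 0) + 1 : ℝ) : EReal))
        (by rw [hsup, EReal.coe_lt_coe_iff]; linarith),
      eventually_lt_of_lt_liminf (b := ((-S.e (fun ω => -X 0 ω) - 1 : ℝ) : EReal))
        (by rw [hinf, EReal.coe_lt_coe_iff]; linarith)] with n h1 h2
    rw [EReal.coe_lt_coe_iff] at h1 h2
    exact abs_le.2 ⟨by linarith [le_max_right (S.e (X 0) + 1) (-(-S.e (fun ω => -X 0 ω) - 1))],
      by linarith [le_max_left (S.e (X 0) + 1) (-(-S.e (fun ω => -X 0 ω) - 1))]⟩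
  have havg : Tendsto (fun n : ℕ => avg X n ω / ((n : ℝ) + 1)) atTop (𝓝 0) := by
    have h0 : Tendsto (fun n : ℕ => C * (1 / ((n : ℝ) + 1))) atTop (𝓝 0) := by
      simpa using tendsto_one_div_add_atTop_nhds_zero_nat.const_mul C
    refine squeeze_zero_norm' ?_ h0
    filter_upwards [hC] with n hn
    have hn1 : (0 : ℝ) < (n : ℝ) + 1 := by positivity
    rw [Real.norm_eq_abs, abs_div, abs_of_pos hn1, mul_one_div]
    gcongr
  -- For `n > 0` the increment of the averages is `X n / (n + 1)` minus the `n`-th average over `n +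
  -- 1`.
  have := (hdiv ω hωA).sub havg
  rw [sub_zero] at this
  refine this.congr' ?_
  filter_upwards [eventually_gt_atTop 0] with n hn
  have hn' : (n : ℝ) ≠ 0 := by exact_mod_cast hn.ne'
  have hn1 : (n : ℝ) + 1 ≠ 0 := by positivity
  rw [avg, avg, Finset.sum_range_succ]
  push_cast
  field_simp
  ring

end SublinExpSpace

theorem theorem4 {Ω : Type*} [MeasurableSpace Ω] (S : SublinExpSpace Ω) (X : ℕ → Ω → ℝ)
    (hX : ∀ n, X n ∈ S.H) (hid : S.IdentDistSeq X) :
    -- (a)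
    (S.NegDepSeq X → CountablySubadditive S.cap →
      choquet S.cap (fun ω => |X 0 ω|) < ⊤ →
      Tendsto (fun c : ℝ => S.E (fun ω => max (|X 0 ω| - c) 0)) atTop (𝓝 0) →
      S.cap ({ω | liminf (fun n => (avg X n ω : EReal)) atTop < S.lowerE (X 0)} ∪
        {ω | S.E (X 0) < limsup (fun n => (avg X n ω : EReal)) atTop}) = 0) ∧
    -- (b)
    (S.IndepSeq X → ContinuousCapacity S.cap →
      S.cap {ω | limsup (fun n => ((|avg X n ω| : ℝ) : EReal)) atTop = ⊤} < 1 →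
      choquet S.cap (fun ω => |X 0 ω|) < ⊤) ∧
    -- (c)
    (S.IndepSeq X → ContinuousCapacity S.cap →
      choquet S.cap (fun ω => |X 0 ω|) < ⊤ →
      Tendsto (fun c : ℝ => S.E (fun ω => max (|X 0 ω| - c) 0)) atTop (𝓝 0) →
      S.cap {ω | liminf (fun n => (avg X n ω : EReal)) atTop = S.lowerE (X 0) ∧
        limsup (fun n => (avg X n ω : EReal)) atTop = S.E (X 0)} = 1 ∧
      S.cap {ω | clusterSet (fun n => avg X n ω) =
        {a : ℝ | S.lowerE (X 0) ≤ (a : EReal) ∧ (a : EReal) ≤ S.E (X 0)}} = 1) := by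
  refine ⟨fun hD hV hc hu => ?_, fun hI hV hlt => ?_, fun hI hV hc hu => ?_⟩
  · exact SublinExpSpace.cap_liminf_lt_union_limsup_gt hV
      (SublinExpSpace.tame_of_choquet hX hid hc hu) (hD.weakNegDep hX) (hD.weakNegDep_neg hX)
  · rw [SublinExpSpace.choquet_abs_lt_top_iff]
    exact fun h => hlt.ne (hI.cap_limsup_abs_avg_eq_one hX hid hV h)
  · have hT := SublinExpSpace.tame_of_choquet hX hid hc hu
    exact ⟨hI.cap_extremes_eq_one hT hV, hI.cap_clusterSet_eq_one hT hV⟩
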